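/- Let $G$ be a finite undirected graph without self-loops or multiple edges, regarded as a bi-directed digraph (each edge $\{i,j\}$ is replaced by the two arcs $w_{ij}$ and $w_{ji}$). Let $\mathcal M_G$ be the trace monoid on the arcs of $G$, i.e. the quotient of the free monoid on the arcs by the congruence generated by $w_{ij}w_{kl}=w_{kl}w_{ij}$ for all arcs with $i\neq k$. A hike on $G$ is a trace $h=w_{i_1j_1}\cdots w_{i_\ell j_\ell}\in\mathcal M_G$ (possibly empty) such that $\#\{k: i_k=v\}=\#\{k: j_k=v\}$ for every vertex $v$. The hikes form a submonoid $\mathcal H_G$ of $\mathcal M_G$, and the hike poset $P_G$ is $\mathcal H_G$ partially ordered by left division: $d\preceq h$ if and only if $h=d\,h'$ for some $h'\in\mathcal H_G$. **Theorem.** Let $G$ be a finite connected graph with no self-loop that is isomorphic neither to $K_3$ nor to $K_{1,5}$. If $G'$ is any finite connected graph with no self-loop such that the posets $P_G$ and $P_{G'}$ are isomorphic, then $G$ and $G'$ are isomorphic. The two exceptions are genuine: $P_{K_3}$ and $P_{K_{1,5}}$ are isomorphic posets. -/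

import Mathlib

/-! Hikes on a directed graph: traces of arcs (two arcs may be exchanged exactly when they have
different starting points) in which every vertex has as many outgoing as ingoing arcs,
ordered by left division. -/

namespace HikeTheory

universe u

variable {V : Type u}

/-- The arcs of a digraph `D`: the ordered pairs `(i, j)` with an arc from `i` to `j`. -/
def Arc (D : Digraph V) : Type u := {a : V × V // D.Adj a.1 a.2}

/-- The starting point of an arc. -/
def Arc.src {D : Digraph V} (a : Arc D) : V := a.1.1

/-- The end point of an arc. -/
def Arc.tgt {D : Digraph V} (a : Arc D) : V := a.1.2

/-- The elementary commutations: `ab = ba` for two arcs with different starting points. -/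
inductive CommRel (D : Digraph V) : FreeMonoid (Arc D) → FreeMonoid (Arc D) → Prop
  | swap (a b : Arc D) (h : a.src ≠ b.src) :
      CommRel D (FreeMonoid.of a * FreeMonoid.of b) (FreeMonoid.of b * FreeMonoid.of a)

/-- The congruence on words of arcs generated by the elementary commutations. -/
def traceCon (D : Digraph V) : Con (FreeMonoid (Arc D)) := conGen (CommRel D)

/-- The trace monoid (free partially commutative monoid) on the arcs of `D`. -/
abbrev Trace (D : Digraph V) : Type u := (traceCon D).Quotient

/-- The trace represented by a word of arcs. -/
def Trace.mk {D : Digraph V} (w : FreeMonoid (Arc D)) : Trace D := (traceCon D).mk' w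

open Classical in
/-- A word of arcs is balanced if, for every vertex `v`, it has as many arcs (counted with
multiplicity) starting at `v` as arcs ending at `v`. -/
def Balanced {D : Digraph V} (w : FreeMonoid (Arc D)) : Prop :=
  ∀ v : V, (w.toList.map Arc.src).count v = (w.toList.map Arc.tgt).count v

/-- The hikes on `D`: the traces represented by a balanced word, as a submonoid of the trace
monoid. -/
def hikes (D : Digraph V) : Submonoid (Trace D) where
  carrier := {t | ∃ w : FreeMonoid (Arc D), Trace.mk w = t ∧ Balanced w}
  one_mem' := ⟨1, map_one _, fun v => by simp⟩
  mul_mem' := by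
    rintro _ _ ⟨w, rfl, hw⟩ ⟨w', rfl, hw'⟩
    refine ⟨w * w', map_mul _ _ _, fun v => ?_⟩
    simp [hw v, hw' v]

/-- The number of arcs of a trace. -/
def Trace.length {D : Digraph V} : Trace D →* Multiplicative ℕ :=
  (traceCon D).lift (FreeMonoid.lift fun _ => Multiplicative.ofAdd 1) <| Con.conGen_le.2 <| by
    rintro _ _ ⟨a, b, -⟩
    rw [Con.ker_rel, map_mul, map_mul, mul_comm]

theorem Trace.eq_one_of_length {D : Digraph V} (t : Trace D) (h : t.length = 1) : t = 1 := by
  induction t using Con.induction_on with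
  | H w =>
    induction w using FreeMonoid.casesOn with
    | one => rfl
    | of_mul a w =>
      have h1 : (FreeMonoid.lift fun _ : Arc D => Multiplicative.ofAdd (1 : ℕ))
          (FreeMonoid.of a * w) = 1 := h
      rw [map_mul, FreeMonoid.lift_eval_of] at h1
      have h2 := congrArg Multiplicative.toAdd h1
      simp at h2

/-- The type of hikes on `D`; it carries the order given by left division. -/
def HikePoset (D : Digraph V) : Type u := hikes D

/-- Left division: `d ≤ h` if and only if `h = d h'` for some hike `h'`. -/
instance (D : Digraph V) : PartialOrder (HikePoset D) where
  le := fun d h : hikes D => ∃ h' : hikes D, h = d * h'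
  le_refl d := ⟨1, (mul_one _).symm⟩
  le_trans := by
    rintro a _ _ ⟨x, rfl⟩ ⟨y, rfl⟩
    exact ⟨x * y, mul_assoc _ _ _⟩
  le_antisymm := by
    rintro (a : hikes D) (b : hikes D) ⟨x, hx⟩ ⟨y, hy⟩
    have h1 : a.1 = a.1 * (x.1 * y.1) := by
      rw [← mul_assoc]
      exact congrArg Subtype.val (hx ▸ hy)
    have h2 : Trace.length x.1 = 1 := by
      have h3 := congrArg (fun t => Multiplicative.toAdd (Trace.length t)) h1
      simp only [map_mul, toAdd_mul] at h3
      apply Multiplicative.toAdd.injective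
      rw [toAdd_one]
      omega
    have h4 : x = 1 := Subtype.ext (Trace.eq_one_of_length _ h2)
    rw [h4, mul_one] at hx
    exact hx.symm

/-- The bi-directed version of an undirected graph: each edge is replaced by two opposite arcs. -/
def bidirected (G : SimpleGraph V) : Digraph V where
  Adj := G.Adj

end HikeTheory

/-! A trace amounts to a choice, at each vertex, of the list of end points of the arcs leaving it.
Under this description left division of hikes is the prefix order at every vertex
(`HikePoset.le_iff`). The atoms of the hike poset are then the directed simple cycles, backtracks
along edges included, and two distinct atoms have a common upper bound exactly when the cycles are
disjoint (`SimpleCycle.meets_iff`). So the poset determines the relation "to meet" on simple cycles,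
and only this relation is used afterwards.

The next task is to find the edges among the cycles. Call cycles twins if they meet the same cycles.
If the connected graph is not a triangle, a cycle whose set of met cycles is minimal is an edge. In
a class of twins that is not minimal, reversal of direction fixes exactly the edges, so the number
of edges is known modulo 2. It exceeds 1 only for two sides of a triangle attached to the rest at
their common vertex, and the third side betrays this case. Hence the number of edges in each class
can be read from the meeting relation (`SimpleCycle.card_twin_edges`). A bijection of cycles can
therefore be rearranged inside the classes so as to send edges to edges
(`CyclesIso.exists_edge_equiv`).

This is an isomorphism of line graphs, and Whitney's theorem (`IsEdgeModel.nonempty_iso`) gives an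
isomorphism of the graphs if neither is a triangle. Its proof separates stars of three edges from
triangles by parity: any further edge touches zero or two sides of a triangle. Stars with the same
property occur only in graphs on four vertices, which are treated directly.

In a triangle, as in a star, any two cycles meet. The hikes then form the free monoid on the cycles,
ordered by prefixes, so only the number of cycles matters: five for K₃ (three backtracks and two
orientations of the triangle) and five for K₁,₅. This gives the exceptional isomorphism. It also
settles the case where the second graph is K₃, by replacing it with K₁,₅. -/

namespace HikeTheory

universe u

variable {V : Type u}

/-! ### Hikes as families of lists, one list at each vertex -/

open Classical in
/-- The list of the end points of the arcs of a trace that start at `v`. -/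
noncomputable def Trace.out {D : Digraph V} (v : V) : Trace D →* FreeMonoid V :=
  (traceCon D).lift
    (FreeMonoid.lift fun a => if a.src = v then FreeMonoid.of a.tgt else 1) <| Con.conGen_le.2 <| by
    rintro _ _ ⟨a, b, h⟩
    rw [Con.ker_rel, map_mul, map_mul, FreeMonoid.lift_eval_of, FreeMonoid.lift_eval_of]
    split_ifs with h1 h2
    · exact absurd (h1.trans h2.symm) h
    all_goals simp

theorem Trace.out_of {D : Digraph V} (a : Arc D) (v : V) [Decidable (a.src = v)] :
    Trace.out v (Trace.mk (FreeMonoid.of a)) = if a.src = v then FreeMonoid.of a.tgt else 1 := by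
  have h := FreeMonoid.lift_eval_of
    (fun a : Arc D => open Classical in if a.src = v then FreeMonoid.of a.tgt else 1) a
  refine Eq.trans h ?_
  congr

theorem Trace.mk_mul {D : Digraph V} (w w' : FreeMonoid (Arc D)) :
    Trace.mk (w * w') = Trace.mk w * Trace.mk w' := map_mul _ _ _

theorem Trace.mk_of_mul_comm {D : Digraph V} {a b : Arc D} (h : a.src ≠ b.src) :
    Trace.mk (FreeMonoid.of a) * Trace.mk (FreeMonoid.of b) =
      Trace.mk (FreeMonoid.of b) * Trace.mk (FreeMonoid.of a) := by
  rw [← Trace.mk_mul, ← Trace.mk_mul]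
  exact (Con.eq _).2 (ConGen.Rel.of _ _ (CommRel.swap a b h))

/-- If the first arc at the starting point of `a` is `a`, then `a` can be moved to the front. -/
theorem Trace.exists_eq_of_mul {D : Digraph V} (a : Arc D) (w : FreeMonoid (Arc D))
    (l : FreeMonoid V) (h : Trace.out a.src (Trace.mk w) = FreeMonoid.of a.tgt * l) :
    ∃ w', Trace.mk w = Trace.mk (FreeMonoid.of a) * Trace.mk w' := by
  classical
  induction w using FreeMonoid.inductionOn' with
  | one =>
    have := congrArg FreeMonoid.length h
    simp [Trace.mk] at this
    omega
  | of_mul b w ih =>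
    rw [Trace.mk_mul, map_mul, Trace.out_of] at h
    rw [Trace.mk_mul]
    by_cases hb : b.src = a.src
    · rw [if_pos hb] at h
      have h1 : b.tgt = a.tgt := (List.cons_eq_cons.1 (congrArg FreeMonoid.toList h)).1
      have h2 : b = a := Subtype.ext (Prod.ext hb h1)
      exact ⟨w, by rw [h2]⟩
    · rw [if_neg hb, one_mul] at h
      obtain ⟨w', hw'⟩ := ih h
      exact ⟨FreeMonoid.of b * w', by
        rw [hw', Trace.mk_mul, ← mul_assoc, ← mul_assoc, Trace.mk_of_mul_comm hb]⟩

/-- The first arc of one word heads the list at its starting point in the other trace, so it can be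
moved to the front there and cancelled. -/
theorem Trace.ext_out {D : Digraph V} {s t : Trace D} (h : ∀ v, Trace.out v s = Trace.out v t) :
    s = t := by
  classical
  obtain ⟨w, rfl⟩ := Con.mk'_surjective s
  obtain ⟨w', rfl⟩ := Con.mk'_surjective t
  change Trace.mk w = Trace.mk w'
  replace h : ∀ v, Trace.out v (Trace.mk w) = Trace.out v (Trace.mk w') := h
  induction w using FreeMonoid.inductionOn' generalizing w' with
  | one =>
    induction w' using FreeMonoid.casesOn with
    | one => rfl
    | of_mul b w' =>
      have := congrArg FreeMonoid.length (h b.src)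
      rw [Trace.mk_mul, map_mul, Trace.out_of] at this
      simp [Trace.mk] at this
      omega
  | of_mul a w ih =>
    have h1 := h a.src
    rw [Trace.mk_mul, map_mul, Trace.out_of, if_pos rfl] at h1
    obtain ⟨w'', hw⟩ := Trace.exists_eq_of_mul a w' _ h1.symm
    rw [Trace.mk_mul, hw, ih w'' fun v => ?_]
    have h2 := h v
    rw [Trace.mk_mul, hw, map_mul, map_mul] at h2
    exact mul_left_cancel h2

theorem Trace.adj_of_mem_out {D : Digraph V} (t : Trace D) {u v : V}
    (h : u ∈ (Trace.out v t).toList) : D.Adj v u := by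
  classical
  obtain ⟨w, rfl⟩ := Con.mk'_surjective t
  replace h : u ∈ (Trace.out v (Trace.mk w)).toList := h
  induction w using FreeMonoid.inductionOn' with
  | one => simp [Trace.mk] at h
  | of_mul a w ih =>
    rw [Trace.mk_mul, map_mul, Trace.out_of, FreeMonoid.toList_mul, List.mem_append] at h
    rcases h with h | h
    · split_ifs at h with ha
      · rw [FreeMonoid.toList_of, List.mem_singleton] at h
        rw [h, ← ha]
        exact a.2
      · simp at h
    · exact ih h

theorem Trace.exists_out_single (D : Digraph V) [DecidableEq V] (v : V) (l : List V)
    (h : ∀ u ∈ l, D.Adj v u) :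
    ∃ t : Trace D, ∀ x, (Trace.out x t).toList = if x = v then l else [] := by
  induction l with
  | nil => exact ⟨1, by simp⟩
  | cons u l ih =>
    obtain ⟨t, ht⟩ := ih fun x hx => h x (List.mem_cons_of_mem _ hx)
    let a : Arc D := ⟨(v, u), h u List.mem_cons_self⟩
    have ha : a.src = v := rfl
    have ha' : a.tgt = u := rfl
    refine ⟨Trace.mk (FreeMonoid.of a) * t, fun x => ?_⟩
    rw [map_mul, Trace.out_of, FreeMonoid.toList_mul, ht]
    simp only [ha, ha']
    by_cases hx : x = v
    · simp [hx]
    · simp [hx, Ne.symm hx]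

theorem Trace.exists_out (D : Digraph V) [Fintype V] (l : V → List V)
    (h : ∀ v, ∀ u ∈ l v, D.Adj v u) : ∃ t : Trace D, ∀ v, (Trace.out v t).toList = l v := by
  classical
  suffices H : ∀ s : Finset V, ∃ t : Trace D, ∀ v,
      (Trace.out v t).toList = if v ∈ s then l v else [] by
    simpa using H Finset.univ
  intro s
  induction s using Finset.induction_on with
  | empty => exact ⟨1, by simp⟩
  | insert a s ha ih =>
    obtain ⟨t, ht⟩ := ih
    obtain ⟨t', ht'⟩ := Trace.exists_out_single D a (l a) (h a)
    refine ⟨t' * t, fun v => ?_⟩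
    rw [map_mul, FreeMonoid.toList_mul, ht, ht']
    by_cases hv : v = a
    · subst hv; simp [ha]
    · simp [hv]

/-- The lists count the arcs leaving a vertex by length and those entering it by occurrences, so
balance depends on the trace and not on the word chosen. -/
theorem balanced_iff {D : Digraph V} [Fintype V] [DecidableEq V] (w : FreeMonoid (Arc D)) :
    Balanced w ↔ ∀ u, (Trace.out u (Trace.mk w)).toList.length =
      ∑ v, (Trace.out v (Trace.mk w)).toList.count u := by
  have h1 : ∀ u, (w.toList.map Arc.src).count u = (Trace.out u (Trace.mk w)).toList.length := by
    intro u
    induction w using FreeMonoid.inductionOn' with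
    | one => simp [Trace.mk]
    | of_mul a w ih =>
      rw [FreeMonoid.toList_mul, List.map_append, List.count_append, ih, Trace.mk_mul, map_mul,
        Trace.out_of, FreeMonoid.toList_mul, List.length_append]
      by_cases h : a.src = u
      · simp [h]
      · simp [h]
  have h2 : ∀ u, (w.toList.map Arc.tgt).count u =
      ∑ v, (Trace.out v (Trace.mk w)).toList.count u := by
    intro u
    clear h1
    induction w using FreeMonoid.inductionOn' with
    | one => simp [Trace.mk]
    | of_mul a w ih =>
      simp only [FreeMonoid.toList_mul, List.map_append, List.count_append, ih, Trace.mk_mul,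
        map_mul, Trace.out_of, Finset.sum_add_distrib]
      congr 1
      rw [Finset.sum_eq_single a.src]
      · simp
      · intro b _ hb
        simp [Ne.symm hb]
      · simp
  unfold Balanced
  refine forall_congr' fun u => ?_
  rw [← h1, ← h2]
  convert Iff.rfl

/-- The list of the end points of the arcs of a hike that start at `v`. -/
noncomputable def HikePoset.out {D : Digraph V} (h : HikePoset D) (v : V) : List V :=
  (Trace.out v h.1).toList

theorem HikePoset.adj_of_mem_out {D : Digraph V} (h : HikePoset D) {u v : V} (hu : u ∈ h.out v) :
    D.Adj v u := Trace.adj_of_mem_out _ hu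

theorem HikePoset.length_out {D : Digraph V} [Fintype V] [DecidableEq V] (h : HikePoset D) (u : V) :
    (h.out u).length = ∑ v, (h.out v).count u := by
  obtain ⟨t, w, rfl, hw⟩ := h
  exact (balanced_iff w).1 hw u

theorem HikePoset.exists_out (D : Digraph V) [Fintype V] [DecidableEq V] (l : V → List V)
    (h : ∀ v, ∀ u ∈ l v, D.Adj v u) (hl : ∀ u, (l u).length = ∑ v, (l v).count u) :
    ∃ p : HikePoset D, ∀ v, p.out v = l v := by
  obtain ⟨t, ht⟩ := Trace.exists_out D l h
  obtain ⟨w, rfl⟩ := Con.mk'_surjective t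
  refine ⟨⟨_, w, rfl, (balanced_iff w).2 fun u => ?_⟩, ht⟩
  have : ∀ v, (Trace.out v (Trace.mk w)).toList = l v := ht
  simp only [this, hl]

theorem HikePoset.ext_out {D : Digraph V} {p q : HikePoset D} (h : ∀ v, p.out v = q.out v) :
    p = q :=
  Subtype.ext <| Trace.ext_out fun v => FreeMonoid.toList.injective (h v)

/-- The product of two hikes. -/
noncomputable def HikePoset.mul {D : Digraph V} (p q : HikePoset D) : HikePoset D :=
  ⟨p.1 * q.1, (hikes D).mul_mem p.2 q.2⟩

theorem HikePoset.out_mul {D : Digraph V} (p q : HikePoset D) (v : V) :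
    (p.mul q).out v = p.out v ++ q.out v := by
  change (Trace.out v (p.1 * q.1)).toList = _
  rw [map_mul, FreeMonoid.toList_mul]
  rfl

theorem HikePoset.le_iff_exists_mul {D : Digraph V} (p q : HikePoset D) :
    p ≤ q ↔ ∃ r, q = p.mul r := by
  constructor
  · rintro ⟨r, hr⟩
    exact ⟨r, hr⟩
  · rintro ⟨r, hr⟩
    exact ⟨r, hr⟩

/-- The remainders after removing the prefixes follow arcs, and they are balanced because both hikes
are; so they come from a hike, which is the quotient. -/
theorem HikePoset.le_iff {D : Digraph V} [Finite V] (p q : HikePoset D) :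
    p ≤ q ↔ ∀ v, p.out v <+: q.out v := by
  classical
  have := Fintype.ofFinite V
  rw [HikePoset.le_iff_exists_mul]
  constructor
  · rintro ⟨r, rfl⟩ v
    exact ⟨r.out v, (HikePoset.out_mul p r v).symm⟩
  · intro h
    choose l hl using h
    obtain ⟨r, hr⟩ := HikePoset.exists_out D l
      (fun v u hu => q.adj_of_mem_out (by rw [← hl v]; exact List.mem_append_right _ hu))
      (fun u => by
        have h1 := q.length_out u
        have h2 := p.length_out u
        simp only [← hl, List.length_append, List.count_append, Finset.sum_add_distrib] at h1
        omega)
    exact ⟨r, HikePoset.ext_out fun v => by rw [HikePoset.out_mul, hr, hl]⟩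

noncomputable instance (D : Digraph V) : OrderBot (HikePoset D) where
  bot := (1 : hikes D)
  bot_le p := ⟨p, (one_mul _).symm⟩

theorem HikePoset.out_bot {D : Digraph V} (v : V) : (⊥ : HikePoset D).out v = [] := by
  change (Trace.out v (1 : Trace D)).toList = _
  rw [map_one]
  rfl

/-! ### Simple cycles as the atoms of the hike poset -/

/-- A self-map without fixed points on a nonempty invariant subset of a finite type agrees with
some cyclic permutation on the support of the latter. -/
theorem exists_isCycle_of_mapsTo [Finite V] (f : V → V) (S : Set V) (hS : S.Nonempty)
    (hf : ∀ v ∈ S, f v ∈ S) (hne : ∀ v ∈ S, f v ≠ v) :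
    ∃ σ : Equiv.Perm V, σ.IsCycle ∧ ∀ v, σ v ≠ v → v ∈ S ∧ σ v = f v := by
  classical
  obtain ⟨T, ⟨hT1, hT2, hT3⟩, hmin⟩ := exists_minimal_of_wellFoundedLT
    (fun T : Set V => T.Nonempty ∧ T ⊆ S ∧ ∀ v ∈ T, f v ∈ T) ⟨S, hS, subset_rfl, hf⟩
  have key : ∀ U : Set V, U.Nonempty → U ⊆ T → (∀ v ∈ U, f v ∈ U) → T ⊆ U :=
    fun U h1 h2 h3 => hmin ⟨h1, h2.trans hT2, h3⟩ h2
  -- On a minimal invariant set `T` the map is onto, since its image is invariant too, hence it is a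
  -- permutation. The forward orbit of a point is invariant as well, so it is all of `T` and the
  -- permutation is a single cycle.
  let g : T → T := fun v => ⟨f v, hT3 v v.2⟩
  have hg : Function.Surjective g := by
    intro v
    have h := key (f '' T) (hT1.image f) (by rintro _ ⟨x, hx, rfl⟩; exact hT3 x hx)
      (by rintro _ ⟨x, hx, rfl⟩; exact ⟨_, hT3 x hx, rfl⟩) v.2
    obtain ⟨x, hx, hxv⟩ := h
    exact ⟨⟨x, hx⟩, Subtype.ext hxv⟩
  let e : Equiv.Perm T := Equiv.ofBijective g (Finite.injective_iff_bijective.1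
    (Finite.injective_iff_surjective.2 hg))
  have he : ∀ v ∈ T, Equiv.Perm.ofSubtype e v = f v := fun v hv => by
    rw [Equiv.Perm.ofSubtype_apply_of_mem e hv]
    rfl
  have he' : ∀ v, Equiv.Perm.ofSubtype e v ≠ v → v ∈ T := fun v hv => by
    by_contra h
    exact hv (Equiv.Perm.ofSubtype_apply_of_not_mem e h)
  refine ⟨Equiv.Perm.ofSubtype e, ?_, fun v hv => ⟨hT2 (he' v hv), he v (he' v hv)⟩⟩
  obtain ⟨x, hx⟩ := hT1
  refine ⟨x, by rw [he x hx]; exact hne x (hT2 hx), fun y hy => ?_⟩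
  obtain ⟨-, n, hn⟩ := key {z | z ∈ T ∧ ∃ n : ℕ, (Equiv.Perm.ofSubtype e ^ n) x = z}
    ⟨x, hx, 0, rfl⟩ (fun z hz => hz.1)
    (by
      rintro z ⟨hz, n, hn⟩
      refine ⟨hT3 z hz, n + 1, ?_⟩
      rw [pow_succ', Equiv.Perm.mul_apply, hn, he z hz]) (he' y hy)
  exact ⟨n, by simpa using hn⟩

/-- The directed simple cycles of a graph (including the backtracks along an edge), given as cyclic
permutations of the vertices. -/
def SimpleCycle (G : SimpleGraph V) : Type u :=
  {σ : Equiv.Perm V // σ.IsCycle ∧ ∀ v, σ v ≠ v → G.Adj v (σ v)}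

namespace SimpleCycle

variable {G : SimpleGraph V}

instance [Finite V] : Finite (SimpleCycle G) := Subtype.finite

/-- Two cycles meet if they have a common vertex. -/
def Meets (σ τ : SimpleCycle G) : Prop := ∃ v, σ.1 v ≠ v ∧ τ.1 v ≠ v

theorem Meets.symm {σ τ : SimpleCycle G} (h : σ.Meets τ) : τ.Meets σ :=
  h.imp fun _ h => h.symm

theorem meets_self (σ : SimpleCycle G) : σ.Meets σ :=
  let ⟨v, hv, _⟩ := σ.2.1
  ⟨v, hv, hv⟩

theorem exists_moved (σ : SimpleCycle G) : ∃ v, σ.1 v ≠ v := σ.2.1.imp fun _ h => h.1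

theorem apply_moved {σ : SimpleCycle G} {v : V} (h : σ.1 v ≠ v) : σ.1 (σ.1 v) ≠ σ.1 v :=
  fun h' => h (σ.1.injective h')

theorem eq_of_eq_on [Finite V] {σ τ : SimpleCycle G} (h : σ.Meets τ)
    (h' : ∀ v, σ.1 v ≠ v → τ.1 v ≠ v → σ.1 v = τ.1 v) : σ = τ := by
  classical
  have := Fintype.ofFinite V
  obtain ⟨v, h1, h2⟩ := h
  refine Subtype.ext (σ.2.1.eq_on_support_inter_nonempty_congr τ.2.1 (fun x hx => ?_)
    (h' v h1 h2) (Equiv.Perm.mem_support.2 h1))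
  rw [Finset.mem_inter, Equiv.Perm.mem_support, Equiv.Perm.mem_support] at hx
  exact h' x hx.1 hx.2

theorem mem_of_closed [Finite V] (σ : SimpleCycle G) (S : Set V) {v : V} (hv : σ.1 v ≠ v)
    (hvS : v ∈ S) (hS : ∀ x ∈ S, σ.1 x ∈ S) {w : V} (hw : σ.1 w ≠ w) : w ∈ S := by
  obtain ⟨n, rfl⟩ := σ.2.1.exists_pow_eq hv hw
  clear hw
  induction n with
  | zero => exact hvS
  | succ n ih => rw [pow_succ', Equiv.Perm.mul_apply]; exact hS _ ih

open Classical in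
/-- The list of vertices that follow `v` on a cycle. -/
noncomputable def next (σ : SimpleCycle G) (v : V) : List V :=
  if σ.1 v = v then [] else [σ.1 v]

theorem next_of_moved {σ : SimpleCycle G} {v : V} (h : σ.1 v ≠ v) : σ.next v = [σ.1 v] := if_neg h

theorem next_of_fixed {σ : SimpleCycle G} {v : V} (h : σ.1 v = v) : σ.next v = [] := if_pos h

theorem adj_of_mem_next {σ : SimpleCycle G} {u v : V} (h : u ∈ σ.next v) : G.Adj v u := by
  by_cases hv : σ.1 v = v
  · simp [next_of_fixed hv] at h
  · rw [next_of_moved hv, List.mem_singleton] at h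
    exact h ▸ σ.2.2 v hv

theorem length_next [Fintype V] [DecidableEq V] (σ : SimpleCycle G) (u : V) :
    (σ.next u).length = ∑ v, (σ.next v).count u := by
  rw [Finset.sum_eq_single (σ.1.symm u)]
  · by_cases hu : σ.1 u = u
    · have : σ.1 (σ.1.symm u) = σ.1.symm u := by
        rw [Equiv.apply_symm_apply, Equiv.eq_symm_apply, hu]
      simp [next_of_fixed hu, next_of_fixed this]
    · have : σ.1 (σ.1.symm u) ≠ σ.1.symm u := by
        rwa [Equiv.apply_symm_apply, ne_eq, Equiv.eq_symm_apply]
      simp [next_of_moved hu, next_of_moved this]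
  · intro b _ hb
    by_cases h : σ.1 b = b
    · simp [next_of_fixed h]
    · have : σ.1 b ≠ u := fun h' => hb (by rw [← h', Equiv.symm_apply_apply])
      simp [next_of_moved h, this]
  · simp

theorem exists_toHike [Finite V] (σ : SimpleCycle G) :
    ∃ p : HikePoset (bidirected G), ∀ v, p.out v = σ.next v := by
  classical
  have := Fintype.ofFinite V
  exact HikePoset.exists_out _ _ (fun v u hu => adj_of_mem_next hu) σ.length_next

/-- The hike that runs once along a simple cycle. -/
noncomputable def toHike [Finite V] (σ : SimpleCycle G) : HikePoset (bidirected G) :=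
  σ.exists_toHike.choose

theorem out_toHike [Finite V] (σ : SimpleCycle G) (v : V) : σ.toHike.out v = σ.next v :=
  σ.exists_toHike.choose_spec v

theorem toHike_ne_bot [Finite V] (σ : SimpleCycle G) : σ.toHike ≠ ⊥ := by
  intro h
  obtain ⟨v, hv⟩ := σ.exists_moved
  have h1 := σ.out_toHike v
  rw [h, HikePoset.out_bot, next_of_moved hv] at h1
  simp at h1

theorem exists_tail_of_toHike_le [Finite V] {σ : SimpleCycle G} {p : HikePoset (bidirected G)}
    (h : σ.toHike ≤ p) {v : V} (hv : σ.1 v ≠ v) : ∃ l, p.out v = σ.1 v :: l := by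
  obtain ⟨l, hl⟩ := (HikePoset.le_iff _ _).1 h v
  rw [out_toHike, next_of_moved hv] at hl
  exact ⟨l, hl.symm⟩

/-- At a common vertex both cycles prescribe the first entry of the list of `p`, so they agree
there; cycles that meet and agree at all common vertices are equal. -/
theorem eq_of_toHike_le [Finite V] {σ τ : SimpleCycle G} (hm : σ.Meets τ)
    {p : HikePoset (bidirected G)} (hσ : σ.toHike ≤ p) (hτ : τ.toHike ≤ p) : σ = τ := by
  refine eq_of_eq_on hm fun v h1 h2 => ?_
  obtain ⟨l, hl⟩ := exists_tail_of_toHike_le hσ h1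
  obtain ⟨l', hl'⟩ := exists_tail_of_toHike_le hτ h2
  rw [hl] at hl'
  exact (List.cons_eq_cons.1 hl').1

/-- Follow the first arc at each vertex with a nonempty list. By balance its end point again has a
nonempty list, and it differs from the vertex because there are no loops, so the walk eventually
runs around a simple cycle. -/
theorem exists_toHike_le [Finite V] {p : HikePoset (bidirected G)} (hp : p ≠ ⊥) :
    ∃ σ : SimpleCycle G, σ.toHike ≤ p := by
  classical
  have := Fintype.ofFinite V
  have hne : {v | p.out v ≠ []}.Nonempty := by
    by_contra h
    rw [Set.not_nonempty_iff_eq_empty, Set.eq_empty_iff_forall_notMem] at h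
    refine hp (HikePoset.ext_out fun v => ?_)
    rw [HikePoset.out_bot]
    exact not_not.1 (h v)
  have hmem : ∀ v, p.out v ≠ [] → (p.out v).headD v ∈ p.out v := by
    intro v hv
    obtain ⟨a, l, h⟩ := List.exists_cons_of_ne_nil hv
    rw [h]
    simp
  obtain ⟨σ, hσ, h⟩ := exists_isCycle_of_mapsTo (fun v => (p.out v).headD v) _ hne
    (by
      intro v hv
      have h1 := hmem v hv
      generalize (p.out v).headD v = u at h1
      change p.out u ≠ []
      rw [← List.length_pos_iff, p.length_out]
      exact (List.count_pos_iff.2 h1).trans_le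
        (Finset.single_le_sum (f := fun v => (p.out v).count u) (fun _ _ => Nat.zero_le _)
          (Finset.mem_univ v)))
    (fun v hv => (p.adj_of_mem_out (hmem v hv) : G.Adj _ _).ne')
  have hadj : ∀ v, σ v ≠ v → G.Adj v (σ v) := by
    intro v hv
    obtain ⟨h1, h2⟩ := h v hv
    have h3 := hmem v h1
    rw [← h2] at h3
    exact p.adj_of_mem_out h3
  let τ : SimpleCycle G := ⟨σ, hσ, hadj⟩
  have hτ : τ.1 = σ := rfl
  clear_value τ
  subst hτ
  refine ⟨τ, (HikePoset.le_iff _ _).2 fun v => ?_⟩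
  · rw [out_toHike]
    by_cases hv : τ.1 v = v
    · rw [next_of_fixed hv]
      exact List.nil_prefix
    · rw [next_of_moved hv]
      obtain ⟨h1, h2⟩ := h v hv
      obtain ⟨a, l, h3⟩ := List.exists_cons_of_ne_nil h1
      exact ⟨l, by simp [h2, h3]⟩

theorem toHike_injective [Finite V] :
    Function.Injective (toHike : SimpleCycle G → HikePoset (bidirected G)) := by
  intro σ τ h
  have hle : τ.toHike ≤ σ.toHike := h.ge
  obtain ⟨v, hv⟩ := τ.exists_moved
  refine eq_of_toHike_le ⟨v, fun h' => ?_, hv⟩ le_rfl hle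
  obtain ⟨l, hl⟩ := exists_tail_of_toHike_le hle hv
  rw [out_toHike, next_of_fixed h'] at hl
  simp at hl

theorem eq_of_toHike_le_toHike [Finite V] {σ τ : SimpleCycle G} (h : σ.toHike ≤ τ.toHike) :
    σ = τ := by
  obtain ⟨v, hv⟩ := σ.exists_moved
  refine eq_of_toHike_le ⟨v, hv, fun h' => ?_⟩ h le_rfl
  obtain ⟨l, hl⟩ := exists_tail_of_toHike_le h hv
  rw [out_toHike, next_of_fixed h'] at hl
  simp at hl

theorem isAtom_toHike [Finite V] (σ : SimpleCycle G) : IsAtom σ.toHike := by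
  refine ⟨σ.toHike_ne_bot, fun p hp => ?_⟩
  by_contra h
  obtain ⟨τ, hτ⟩ := exists_toHike_le h
  have := eq_of_toHike_le_toHike (hτ.trans hp.le)
  exact absurd hp (this ▸ hτ).not_gt

theorem exists_toHike_eq [Finite V] {p : HikePoset (bidirected G)} (hp : IsAtom p) :
    ∃ σ : SimpleCycle G, σ.toHike = p := by
  obtain ⟨σ, hσ⟩ := exists_toHike_le hp.1
  refine ⟨σ, hσ.eq_of_not_lt fun h => ?_⟩
  exact σ.toHike_ne_bot (hp.2 _ h)

/-- Disjoint cycles are both prefixes of their superposition, while distinct cycles that meet have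
no common multiple. The right-hand side speaks of the order alone. -/
theorem meets_iff [Finite V] (σ τ : SimpleCycle G) :
    σ.Meets τ ↔ σ = τ ∨ ¬ ∃ p, σ.toHike ≤ p ∧ τ.toHike ≤ p := by
  classical
  have := Fintype.ofFinite V
  constructor
  · intro h
    by_contra! h'
    obtain ⟨h1, p, h2, h3⟩ := h'
    exact h1 (eq_of_toHike_le h h2 h3)
  · rintro (rfl | h)
    · exact σ.meets_self
    · by_contra hm
      obtain ⟨p, hp⟩ := HikePoset.exists_out (bidirected G) (fun v => σ.next v ++ τ.next v)
        (fun v u hu => (List.mem_append.1 hu).elim adj_of_mem_next adj_of_mem_next)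
        (fun u => by simp only [List.length_append, List.count_append, Finset.sum_add_distrib,
          length_next])
      refine h ⟨p, (HikePoset.le_iff _ _).2 fun v => ?_, (HikePoset.le_iff _ _).2 fun v => ?_⟩
      · rw [out_toHike, hp]
        exact List.prefix_append _ _
      · rw [out_toHike, hp]
        by_cases hv : σ.1 v = v
        · rw [next_of_fixed hv]
          exact List.prefix_rfl
        · rw [next_of_fixed (σ := τ) (by_contra fun h' => hm ⟨v, hv, h'⟩)]
          exact List.nil_prefix

/-- The simple cycles correspond to the atoms of the hike poset. -/
noncomputable def equivAtoms [Finite V] (G : SimpleGraph V) :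
    SimpleCycle G ≃ {p : HikePoset (bidirected G) // IsAtom p} :=
  Equiv.ofBijective (fun σ => ⟨σ.toHike, σ.isAtom_toHike⟩)
    ⟨fun _ _ h => toHike_injective (congrArg Subtype.val h),
      fun p => (exists_toHike_eq p.2).imp fun _ h => Subtype.ext h⟩

end SimpleCycle

/-! ### The meeting relation of cycles as an invariant of the poset -/

/-- The cycles of two graphs correspond to each other, preserving whether two cycles meet. -/
def CyclesIso {W : Type*} (G : SimpleGraph V) (H : SimpleGraph W) : Prop :=
  ∃ φ : SimpleCycle G ≃ SimpleCycle H, ∀ σ τ, (φ σ).Meets (φ τ) ↔ σ.Meets τ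

theorem CyclesIso.trans {W X : Type*} {G : SimpleGraph V} {H : SimpleGraph W} {K : SimpleGraph X}
    (h : CyclesIso G H) (h' : CyclesIso H K) : CyclesIso G K := by
  obtain ⟨φ, hφ⟩ := h
  obtain ⟨ψ, hψ⟩ := h'
  exact ⟨φ.trans ψ, fun σ τ => by simp [hφ, hψ]⟩

theorem cyclesIso_of_orderIso {W : Type*} [Finite V] [Finite W] {G : SimpleGraph V}
    {H : SimpleGraph W} (e : HikePoset (bidirected G) ≃o HikePoset (bidirected H)) :
    CyclesIso G H := by
  let φ : SimpleCycle G ≃ SimpleCycle H := (SimpleCycle.equivAtoms G).trans <|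
    (e.toEquiv.subtypeEquiv fun p => (e.isAtom_iff p).symm).trans (SimpleCycle.equivAtoms H).symm
  have hφ : ∀ σ, (φ σ).toHike = e σ.toHike := by
    intro σ
    have : SimpleCycle.equivAtoms H (φ σ) = ⟨e σ.toHike, (e.isAtom_iff _).2 σ.isAtom_toHike⟩ := by
      simp only [φ, Equiv.trans_apply, Equiv.apply_symm_apply]
      rfl
    exact congrArg Subtype.val this
  refine ⟨φ, fun σ τ => ?_⟩
  rw [SimpleCycle.meets_iff, SimpleCycle.meets_iff, φ.apply_eq_iff_eq, hφ, hφ]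
  refine or_congr Iff.rfl (not_congr ⟨?_, ?_⟩)
  · rintro ⟨p, h1, h2⟩
    exact ⟨e.symm p, e.le_symm_apply.2 h1, e.le_symm_apply.2 h2⟩
  · rintro ⟨p, h1, h2⟩
    exact ⟨e p, e.le_iff_le.2 h1, e.le_iff_le.2 h2⟩

theorem isCycle_permCongr {W : Type*} (e : V ≃ W) {σ : Equiv.Perm V} (h : σ.IsCycle) :
    (e.permCongr σ).IsCycle := by
  have hpow : ∀ n : ℤ, e.permCongr σ ^ n = e.permCongr (σ ^ n) := fun n =>
    (map_zpow e.permCongrHom σ n).symm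
  obtain ⟨x, hx, h⟩ := h
  refine ⟨e x, by simpa using hx, fun y hy => ?_⟩
  obtain ⟨n, hn⟩ := h (y := e.symm y) fun h' => hy (by
    rw [Equiv.permCongr_apply, h', e.apply_symm_apply])
  exact ⟨n, by rw [hpow, Equiv.permCongr_apply, e.symm_apply_apply, hn, e.apply_symm_apply]⟩

theorem cyclesIso_of_iso {W : Type*} {G : SimpleGraph V} {H : SimpleGraph W} (f : G ≃g H) :
    CyclesIso G H := by
  have happ : ∀ (σ : Equiv.Perm V) (w : W), f.toEquiv.permCongr σ w = f (σ (f.symm w)) :=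
    fun _ _ => rfl
  have hconj : ∀ (σ : Equiv.Perm V) (w : W),
      f.toEquiv.permCongr σ w ≠ w ↔ σ (f.symm w) ≠ f.symm w := fun σ w => by
    rw [happ]
    exact not_congr ⟨fun h => f.injective (h.trans (f.apply_symm_apply w).symm), fun h => by
      rw [h, f.apply_symm_apply]⟩
  let φ : SimpleCycle G ≃ SimpleCycle H := f.toEquiv.permCongr.subtypeEquiv fun σ => by
    refine and_congr ⟨isCycle_permCongr _, fun h => ?_⟩ ⟨fun h w hw => ?_, fun h v hv => ?_⟩
    · have h1 := isCycle_permCongr f.toEquiv.symm h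
      rwa [← Equiv.permCongr_symm, Equiv.symm_apply_apply] at h1
    · have h1 := f.map_adj_iff.2 (h _ ((hconj σ w).1 hw))
      rwa [f.apply_symm_apply] at h1
    · have h1 := h (f v) ((hconj σ _).2 (by rwa [f.symm_apply_apply]))
      rw [happ, f.symm_apply_apply] at h1
      exact f.map_adj_iff.1 h1
  refine ⟨φ, fun σ τ => ?_⟩
  constructor
  · rintro ⟨w, h1, h2⟩
    exact ⟨f.symm w, (hconj _ _).1 h1, (hconj _ _).1 h2⟩
  · rintro ⟨v, h1, h2⟩
    exact ⟨f v, (hconj _ _).2 (by simpa using h1), (hconj _ _).2 (by simpa using h2)⟩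

/-! ### Free hike monoids and the exceptional pair -/

theorem HikePoset.mul_le_mul_iff {D : Digraph V} [Finite V] {p q r : HikePoset D} :
    p.mul q ≤ p.mul r ↔ q ≤ r := by
  simp only [HikePoset.le_iff, HikePoset.out_mul, List.prefix_append_right_inj]

namespace SimpleCycle

variable {G : SimpleGraph V}

/-- The hike that runs along the cycles of a list one after the other. -/
noncomputable def listProd [Finite V] (l : List (SimpleCycle G)) : HikePoset (bidirected G) :=
  l.foldr (fun σ p => σ.toHike.mul p) ⊥

theorem toHike_le_listProd_cons [Finite V] (σ : SimpleCycle G) (l : List (SimpleCycle G)) :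
    σ.toHike ≤ listProd (σ :: l) :=
  (HikePoset.le_iff_exists_mul _ _).2 ⟨_, rfl⟩

theorem listProd_surjective [Finite V] : Function.Surjective (listProd (G := G)) := by
  classical
  have := Fintype.ofFinite V
  intro p
  generalize hn : ∑ v, (p.out v).length = n
  induction n using Nat.strong_induction_on generalizing p with
  | _ n ih =>
    by_cases hp : p = ⊥
    · exact ⟨[], hp.symm⟩
    · obtain ⟨σ, hσ⟩ := exists_toHike_le hp
      obtain ⟨r, rfl⟩ := (HikePoset.le_iff_exists_mul _ _).1 hσ
      obtain ⟨l, rfl⟩ := ih (∑ v, (r.out v).length) (by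
        rw [← hn]
        obtain ⟨v, hv⟩ := σ.exists_moved
        refine Finset.sum_lt_sum (fun v _ => ?_) ⟨v, Finset.mem_univ v, ?_⟩
        · simp [HikePoset.out_mul]
        · simp [HikePoset.out_mul, out_toHike, next_of_moved hv]) r rfl
      exact ⟨σ :: l, rfl⟩

/-- When any two cycles meet, a hike is divisible by at most one cycle, so factorizations into
cycles are unique and can be compared factor by factor. -/
theorem listProd_le_iff [Finite V] (hG : ∀ σ τ : SimpleCycle G, σ.Meets τ)
    (l l' : List (SimpleCycle G)) : listProd l ≤ listProd l' ↔ l <+: l' := by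
  induction l generalizing l' with
  | nil => exact iff_of_true bot_le List.nil_prefix
  | cons σ l ih =>
    cases l' with
    | nil =>
      refine iff_of_false (fun h => ?_) (by simp)
      exact σ.toHike_ne_bot (le_bot_iff.1 ((toHike_le_listProd_cons σ l).trans h))
    | cons τ l' =>
      rw [List.cons_prefix_cons, ← ih]
      constructor
      · intro h
        obtain rfl := eq_of_toHike_le (hG σ τ) ((toHike_le_listProd_cons σ l).trans h)
          (toHike_le_listProd_cons τ l')
        exact ⟨rfl, HikePoset.mul_le_mul_iff.1 h⟩
      · rintro ⟨rfl, h⟩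
        exact HikePoset.mul_le_mul_iff.2 h

theorem listProd_injective [Finite V] (hG : ∀ σ τ : SimpleCycle G, σ.Meets τ) :
    Function.Injective (listProd (G := G)) := fun l l' h =>
  ((listProd_le_iff hG l l').1 h.le).eq_of_length_le ((listProd_le_iff hG l' l).1 h.ge).length_le

end SimpleCycle

theorem nonempty_orderIso_of_meets {W : Type*} [Finite V] [Finite W] {G : SimpleGraph V}
    {H : SimpleGraph W} (hG : ∀ σ τ : SimpleCycle G, σ.Meets τ)
    (hH : ∀ σ τ : SimpleCycle H, σ.Meets τ) (e : SimpleCycle G ≃ SimpleCycle H) :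
    Nonempty (HikePoset (bidirected G) ≃o HikePoset (bidirected H)) := by
  let eG := Equiv.ofBijective _ ⟨SimpleCycle.listProd_injective hG, SimpleCycle.listProd_surjective⟩
  let eH := Equiv.ofBijective _ ⟨SimpleCycle.listProd_injective hH, SimpleCycle.listProd_surjective⟩
  refine ⟨⟨eG.symm.trans ((Equiv.listEquivOfEquiv e).trans eH), fun {p q} => ?_⟩⟩
  obtain ⟨l, rfl⟩ := eG.surjective p
  obtain ⟨l', rfl⟩ := eG.surjective q
  simp only [Equiv.trans_apply, Equiv.symm_apply_apply]
  refine (SimpleCycle.listProd_le_iff hH _ _).trans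
    (Iff.trans ?_ (SimpleCycle.listProd_le_iff hG _ _).symm)
  exact List.prefix_map_iff_of_injective e.injective

/-- The backtrack along an edge. -/
def SimpleCycle.ofAdj [DecidableEq V] {G : SimpleGraph V} {i j : V} (h : G.Adj i j) :
    SimpleCycle G :=
  ⟨Equiv.swap i j, Equiv.Perm.isCycle_swap h.ne, fun v hv => by
    rcases Equiv.swap_apply_ne_self_iff.1 hv with ⟨-, rfl | rfl⟩
    · rwa [Equiv.swap_apply_left]
    · rw [Equiv.swap_apply_right]
      exact h.symm⟩

theorem card_simpleCycle_completeGraph_three :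
    Nat.card (SimpleCycle (⊤ : SimpleGraph (Fin 3))) = 5 := by
  have h1 : ∀ σ : Equiv.Perm (Fin 3), σ ≠ 1 → σ.IsCycle := by
    -- Exponents below 3 suffice, as cycles on three points have order at most 3; the bound makes
    -- the statement decidable.
    have h : ∀ σ : Equiv.Perm (Fin 3), σ ≠ 1 →
        ∃ x, σ x ≠ x ∧ ∀ y, σ y ≠ y → ∃ n : Fin 3, (σ ^ n.1) x = y := by decide
    intro σ hσ
    obtain ⟨x, hx, h⟩ := h σ hσ
    exact ⟨x, hx, fun y hy => (h y hy).elim fun n hn => ⟨n.1, by simpa using hn⟩⟩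
  have e : SimpleCycle (⊤ : SimpleGraph (Fin 3)) ≃ {σ : Equiv.Perm (Fin 3) // σ ≠ 1} :=
    Equiv.subtypeEquivRight fun σ =>
      ⟨fun h => h.1.ne_one, fun h => ⟨h1 σ h, fun v hv => by simpa using hv.symm⟩⟩
  rw [Nat.card_congr e, Nat.card_eq_fintype_card]
  decide

theorem meets_completeGraph_three (σ τ : SimpleCycle (⊤ : SimpleGraph (Fin 3))) : σ.Meets τ := by
  have h : ∀ σ τ : Equiv.Perm (Fin 3), σ ≠ 1 → τ ≠ 1 → ∃ v, σ v ≠ v ∧ τ v ≠ v := by decide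
  exact h σ.1 τ.1 σ.2.1.ne_one τ.2.1.ne_one

theorem SimpleCycle.star_moves_center {n : ℕ}
    (σ : SimpleCycle (completeBipartiteGraph (Fin 1) (Fin n))) :
    σ.1 (Sum.inl 0) ≠ Sum.inl 0 := by
  obtain ⟨v, hv⟩ := σ.exists_moved
  have h1 := σ.2.2 v hv
  rcases v with v | v
  · rwa [Subsingleton.elim v 0] at hv
  · generalize hw : σ.1 (Sum.inr v) = w at h1
    rcases w with w | w
    · have h2 := SimpleCycle.apply_moved hv
      rwa [hw, Subsingleton.elim w 0] at h2
    · simp at h1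

theorem card_simpleCycle_star (n : ℕ) :
    Nat.card (SimpleCycle (completeBipartiteGraph (Fin 1) (Fin n))) = n := by
  have hadj : ∀ i : Fin n, (completeBipartiteGraph (Fin 1) (Fin n)).Adj (Sum.inl 0) (Sum.inr i) :=
    fun i => by simp
  let f : Fin n → SimpleCycle (completeBipartiteGraph (Fin 1) (Fin n)) :=
    fun i => SimpleCycle.ofAdj (hadj i)
  have hf : ∀ i, (f i).1 = Equiv.swap (Sum.inl 0) (Sum.inr i) := fun _ => rfl
  have hinj : Function.Injective f := by
    intro i j h
    have h1 : (f i).1 (Sum.inl 0) = (f j).1 (Sum.inl 0) := by rw [h]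
    simpa [hf] using h1
  have hsurj : Function.Surjective f := by
    intro σ
    have h0 := σ.star_moves_center
    have h1 := σ.2.2 _ h0
    generalize hw : σ.1 (Sum.inl 0) = w at h1
    rcases w with w | i
    · simp at h1
    · have hi := SimpleCycle.apply_moved h0
      have h2 := σ.2.2 _ hi
      rw [hw] at h2
      generalize hu : σ.1 (Sum.inr i) = u at h2
      rcases u with u | u
      · obtain rfl := Subsingleton.elim u 0
        refine ⟨i, SimpleCycle.eq_of_eq_on ⟨Sum.inl 0, (f i).star_moves_center, h0⟩ ?_⟩
        intro v hv _
        rw [hf] at hv ⊢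
        rcases Equiv.swap_apply_ne_self_iff.1 hv with ⟨-, rfl | rfl⟩
        · rw [Equiv.swap_apply_left, hw]
        · rw [Equiv.swap_apply_right, hu]
      · simp at h2
  rw [← Nat.card_congr (Equiv.ofBijective f ⟨hinj, hsurj⟩), Nat.card_eq_fintype_card,
    Fintype.card_fin]

theorem nonempty_orderIso_completeGraph_three_star_five :
    Nonempty (HikePoset (bidirected (⊤ : SimpleGraph (Fin 3))) ≃o
      HikePoset (bidirected (completeBipartiteGraph (Fin 1) (Fin 5)))) :=
  nonempty_orderIso_of_meets meets_completeGraph_three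
    (fun σ τ => ⟨_, σ.star_moves_center, τ.star_moves_center⟩)
    (Nonempty.some <| Finite.card_eq.1 <| by
      rw [card_simpleCycle_completeGraph_three, card_simpleCycle_star])

/-! ### Recognising the edges among the cycles -/

/-- A graph whose vertices are those of a single triangle. -/
def IsTriangle (G : SimpleGraph V) : Prop :=
  ∃ i j k, G.Adj i j ∧ G.Adj j k ∧ G.Adj i k ∧ ∀ v, v = i ∨ v = j ∨ v = k

theorem mem_of_adj_closed {G : SimpleGraph V} (hG : G.Connected) (S : Set V) {v : V} (hv : v ∈ S)
    (hS : ∀ x ∈ S, ∀ y, G.Adj x y → y ∈ S) (w : V) : w ∈ S := by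
  obtain ⟨p⟩ := hG.preconnected v w
  induction p with
  | nil => exact hv
  | cons h _ ih => exact ih (hS _ hv _ h)

namespace SimpleCycle

variable {G : SimpleGraph V}

/-- A simple cycle of length two. -/
def IsEdge (σ : SimpleCycle G) : Prop := ∀ v, σ.1 (σ.1 v) = v

/-- Every cycle that meets `σ` meets `τ`. -/
def Dominated (σ τ : SimpleCycle G) : Prop := ∀ ρ, σ.Meets ρ → τ.Meets ρ

/-- The cycles `σ` and `τ` meet the same cycles. -/
def Twin (σ τ : SimpleCycle G) : Prop := ∀ ρ, σ.Meets ρ ↔ τ.Meets ρ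

/-- Every cycle dominated by `σ` is a twin of `σ`. -/
def IsMinimal (σ : SimpleCycle G) : Prop := ∀ τ : SimpleCycle G, τ.Dominated σ → σ.Dominated τ

/-- The cycles met by some `x`, apart from `x`, are the twins of `σ`, and their number is even. -/
def IsCap (σ : SimpleCycle G) : Prop :=
  Even (Nat.card {τ // σ.Twin τ}) ∧
    ∃ x : SimpleCycle G, ¬ σ.Twin x ∧ ∀ ρ, x.Meets ρ ↔ ρ = x ∨ σ.Twin ρ

theorem Twin.symm {σ τ : SimpleCycle G} (h : σ.Twin τ) : τ.Twin σ := fun ρ => (h ρ).symm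

theorem Twin.trans {σ τ υ : SimpleCycle G} (h : σ.Twin τ) (h' : τ.Twin υ) : σ.Twin υ :=
  fun ρ => (h ρ).trans (h' ρ)

theorem Twin.dominated {σ τ : SimpleCycle G} (h : σ.Twin τ) : σ.Dominated τ := fun ρ => (h ρ).1

theorem Twin.meets {σ τ : SimpleCycle G} (h : σ.Twin τ) : σ.Meets τ := (h τ).2 τ.meets_self

theorem twin_refl (σ : SimpleCycle G) : σ.Twin σ := fun _ => Iff.rfl

theorem IsMinimal.of_twin {σ τ : SimpleCycle G} (h : σ.IsMinimal) (h' : σ.Twin τ) :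
    τ.IsMinimal := fun υ hυ ρ hρ => h υ (fun π hπ => (h' π).2 (hυ π hπ)) ρ ((h' ρ).2 hρ)

theorem symm_apply_moved {σ : SimpleCycle G} {v : V} (h : σ.1 v ≠ v) :
    σ.1 (σ.1.symm v) ≠ σ.1.symm v := by
  rw [Equiv.apply_symm_apply, ne_eq, Equiv.eq_symm_apply]
  exact h

theorem adj_symm_apply {σ : SimpleCycle G} {v : V} (h : σ.1 v ≠ v) : G.Adj v (σ.1.symm v) := by
  have := σ.2.2 _ (symm_apply_moved h)
  rw [Equiv.apply_symm_apply] at this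
  exact this.symm

section ofAdj

variable [DecidableEq V]

theorem ofAdj_moved_iff {i j : V} (h : G.Adj i j) (v : V) :
    (ofAdj h).1 v ≠ v ↔ v = i ∨ v = j :=
  Equiv.swap_apply_ne_self_iff.trans (and_iff_right h.ne)

theorem ofAdj_left {i j : V} (h : G.Adj i j) : (ofAdj h).1 i = j := Equiv.swap_apply_left _ _

theorem ofAdj_right {i j : V} (h : G.Adj i j) : (ofAdj h).1 j = i := Equiv.swap_apply_right _ _

theorem isEdge_ofAdj {i j : V} (h : G.Adj i j) : (ofAdj h).IsEdge := fun v => by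
  change Equiv.swap i j (Equiv.swap i j v) = v
  rw [← Equiv.Perm.mul_apply, Equiv.swap_mul_self, Equiv.Perm.one_apply]

theorem ofAdj_meets_iff {i j : V} (h : G.Adj i j) (ρ : SimpleCycle G) :
    (ofAdj h).Meets ρ ↔ ρ.1 i ≠ i ∨ ρ.1 j ≠ j := by
  constructor
  · rintro ⟨v, h1, h2⟩
    rcases (ofAdj_moved_iff h v).1 h1 with rfl | rfl
    · exact Or.inl h2
    · exact Or.inr h2
  · rintro (h1 | h1)
    · exact ⟨i, (ofAdj_moved_iff h i).2 (Or.inl rfl), h1⟩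
    · exact ⟨j, (ofAdj_moved_iff h j).2 (Or.inr rfl), h1⟩

theorem IsEdge.eq_ofAdj [Finite V] {σ : SimpleCycle G} (hσ : σ.IsEdge) {v : V} (hv : σ.1 v ≠ v) :
    σ = ofAdj (σ.2.2 v hv) := by
  refine eq_of_eq_on ⟨v, hv, (ofAdj_moved_iff _ v).2 (Or.inl rfl)⟩ fun w _ hw => ?_
  rcases (ofAdj_moved_iff _ w).1 hw with rfl | rfl
  · rw [ofAdj_left]
  · rw [ofAdj_right, hσ]

/-- Domination is tested on the backtrack along `uw`: it meets `σ` at `u`, hence it meets `τ`. -/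
theorem Dominated.moved_or {σ τ : SimpleCycle G} (h : σ.Dominated τ) {u w : V} (hu : σ.1 u ≠ u)
    (huw : G.Adj u w) : τ.1 u ≠ u ∨ τ.1 w ≠ w := by
  rw [← ofAdj_meets_iff huw]
  exact (h _ ((ofAdj_meets_iff huw σ).2 (Or.inl hu)).symm).symm

theorem Dominated.eq_or_eq {σ : SimpleCycle G} {i j : V} {hij : G.Adj i j}
    (h : σ.Dominated (ofAdj hij)) {u w : V} (hu : σ.1 u ≠ u) (hi : u ≠ i) (hj : u ≠ j)
    (huw : G.Adj u w) : w = i ∨ w = j := by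
  rcases h.moved_or hu huw with h1 | h1
  · rcases (ofAdj_moved_iff hij u).1 h1 with h2 | h2
    · exact absurd h2 hi
    · exact absurd h2 hj
  · exact (ofAdj_moved_iff hij w).1 h1

theorem ofAdj_dominated {σ : SimpleCycle G} {i j : V} (hij : G.Adj i j) (hi : σ.1 i ≠ i)
    (hj : σ.1 j ≠ j) : (ofAdj hij).Dominated σ := by
  intro ρ hρ
  rcases (ofAdj_meets_iff hij ρ).1 hρ with h | h
  · exact ⟨i, hi, h⟩
  · exact ⟨j, hj, h⟩

end ofAdj

theorem apply_apply_ne [Finite V] {σ : SimpleCycle G} (hσ : ¬ σ.IsEdge) {v : V} (hv : σ.1 v ≠ v) :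
    σ.1 (σ.1 v) ≠ v := by
  intro h
  refine hσ fun w => ?_
  by_cases hw : σ.1 w = w
  · rw [hw, hw]
  · rcases σ.mem_of_closed {v, σ.1 v} hv (Or.inl rfl) (by
      rintro x (rfl | rfl)
      · exact Or.inr rfl
      · exact Or.inl h) hw with rfl | rfl
    · exact h
    · rw [h]

theorem symm_apply_ne_apply [Finite V] {σ : SimpleCycle G} (hσ : ¬ σ.IsEdge) {v : V}
    (hv : σ.1 v ≠ v) : σ.1.symm v ≠ σ.1 v := fun h =>
  apply_apply_ne hσ hv (by rw [← h, Equiv.apply_symm_apply])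

/-- A long cycle dominates each of its edges, so by minimality each edge dominates it. Then every
vertex of the cycle off that edge has all its neighbours on the edge. Applied to three consecutive
edges, this closes the cycle after three steps and leaves no way out of it, so the connected graph
is a triangle. -/
theorem IsMinimal.isEdge [Finite V] (hG : G.Connected) (hG' : ¬ IsTriangle G) {σ : SimpleCycle G}
    (h : σ.IsMinimal) : σ.IsEdge := by
  classical
  by_contra hσ
  have key : ∀ v, σ.1 v ≠ v → ∀ w, σ.1 w ≠ w → w ≠ v → w ≠ σ.1 v → ∀ u, G.Adj w u →
      u = v ∨ u = σ.1 v := fun v hv w hw h1 h2 u hu =>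
    (h _ (ofAdj_dominated (σ.2.2 v hv) hv (apply_moved hv))).eq_or_eq hw h1 h2 hu
  obtain ⟨v, hv⟩ := σ.exists_moved
  have hu := apply_moved hv
  have hw := apply_moved hu
  have hvw := apply_apply_ne hσ hv
  have h1 := key v hv _ hw hvw hu
  have h2 := key _ hu v hv hv.symm hvw.symm
  have h3 : σ.1 (σ.1 (σ.1 v)) = v := (h1 _ (σ.2.2 _ hw)).resolve_right (apply_apply_ne hσ hu)
  have h4 := key _ hw _ hu hu.symm (by rwa [h3])
  refine hG' ⟨v, σ.1 v, σ.1 (σ.1 v), σ.2.2 v hv, σ.2.2 _ hu, ?_, fun x => ?_⟩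
  · have := (σ.2.2 _ hw).symm
    rwa [h3] at this
  · refine mem_of_adj_closed hG {x | x = v ∨ x = σ.1 v ∨ x = σ.1 (σ.1 v)} (Or.inl rfl) ?_ x
    rintro x (rfl | rfl | rfl) y hy
    · exact Or.inr (h2 y hy)
    · rcases h4 y hy with h | h
      · exact Or.inr (Or.inr h)
      · exact Or.inl (h.trans h3)
    · rcases h1 y hy with h | h
      · exact Or.inl h
      · exact Or.inr (Or.inl h)

/-- Every cycle that meets the pendant edge passes through `i`, so any two such cycles meet. -/
theorem isMinimal_ofAdj_of_leaf [DecidableEq V] {i j : V} (h : G.Adj i j)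
    (hj : ∀ u, G.Adj j u → u = i) : (ofAdj h).IsMinimal := by
  have key : ∀ ρ : SimpleCycle G, (ofAdj h).Meets ρ → ρ.1 i ≠ i := by
    intro ρ hρ
    rcases (ofAdj_meets_iff h ρ).1 hρ with h1 | h1
    · exact h1
    · have h2 := apply_moved h1
      rwa [hj _ (ρ.2.2 j h1)] at h2
  exact fun τ hτ ρ hρ => ⟨i, key τ (hτ τ τ.meets_self), key ρ hρ⟩

/-- The cycle traversed in the opposite direction. -/
def reverse (σ : SimpleCycle G) : SimpleCycle G :=
  ⟨σ.1.symm, σ.2.1.inv, fun v hv => by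
    have h : σ.1 v ≠ v := fun h => hv (by rw [Equiv.symm_apply_eq, h])
    exact adj_symm_apply h⟩

theorem reverse_apply (σ : SimpleCycle G) (v : V) : σ.reverse.1 v = σ.1.symm v := rfl

theorem reverse_moved_iff (σ : SimpleCycle G) (v : V) : σ.reverse.1 v ≠ v ↔ σ.1 v ≠ v := by
  rw [reverse_apply, ne_eq, ne_eq, Equiv.symm_apply_eq, eq_comm]

theorem twin_reverse (σ : SimpleCycle G) : σ.Twin σ.reverse := fun ρ => by
  simp only [Meets, reverse_moved_iff]

theorem reverse_eq_self_iff (σ : SimpleCycle G) : σ.reverse = σ ↔ σ.IsEdge := by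
  constructor
  · intro h v
    have h1 : σ.reverse.1 (σ.1 v) = σ.1 (σ.1 v) := by rw [h]
    rw [← h1, reverse_apply, Equiv.symm_apply_apply]
  · intro h
    refine Subtype.ext (Equiv.ext fun v => ?_)
    rw [reverse_apply, Equiv.symm_apply_eq, h]

/-- Reversal is an involution on the class of twins, and its fixed points are the edges. -/
theorem card_twin_modEq [Finite V] (σ : SimpleCycle G) :
    Nat.card {τ // σ.Twin τ} ≡ Nat.card {τ // σ.Twin τ ∧ τ.IsEdge} [MOD 2] := by
  classical
  have := Fintype.ofFinite {τ // σ.Twin τ}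
  have : Fact (Nat.Prime 2) := ⟨Nat.prime_two⟩
  let f : Function.End {τ // σ.Twin τ} := fun τ => ⟨τ.1.reverse, τ.2.trans τ.1.twin_reverse⟩
  have hf : f ^ 2 ^ 1 = 1 := by
    funext τ
    rfl
  have e : Function.fixedPoints f ≃ {τ // σ.Twin τ ∧ τ.IsEdge} :=
    (Equiv.subtypeEquivRight fun τ => by
      change f τ = τ ↔ τ.1.IsEdge
      rw [← reverse_eq_self_iff, Subtype.ext_iff]).trans
        (Equiv.subtypeSubtypeEquivSubtypeInter _ _)
  have h := Equiv.Perm.card_fixedPoints_modEq hf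
  rwa [← Nat.card_eq_fintype_card, ← Nat.card_eq_fintype_card, Nat.card_congr e] at h

/-- Two edges that are twins but not minimal are two sides of a triangle attached at their common
vertex; the third side then meets only its twins and itself. -/
theorem exists_of_twin_edges [Finite V] (hG : G.Connected) (hG' : ¬ IsTriangle G)
    {e f : SimpleCycle G} (he : e.IsEdge) (hf : f.IsEdge) (hef : e.Twin f) (hne : e ≠ f)
    (hmin : ¬ e.IsMinimal) :
    (∃ x : SimpleCycle G, ¬ e.Twin x ∧ ∀ ρ, x.Meets ρ ↔ ρ = x ∨ e.Twin ρ) ∧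
      ∀ ρ, e.Twin ρ ∧ ρ.IsEdge ↔ ρ = e ∨ ρ = f := by
  classical
  obtain ⟨i, hi, hi'⟩ := hef.meets
  obtain ⟨j, hij, he'⟩ : ∃ j, ∃ hij : G.Adj i j, e = ofAdj hij := ⟨_, _, he.eq_ofAdj hi⟩
  obtain ⟨k, hik, hf'⟩ : ∃ k, ∃ hik : G.Adj i k, f = ofAdj hik := ⟨_, _, hf.eq_ofAdj hi'⟩
  have hjk : j ≠ k := by
    rintro rfl
    exact hne (he'.trans hf'.symm)
  clear hi hi'
  subst he' hf'
  -- As `j` does not lie on `f`, every edge at `j` must meet the twin `f` at its other end;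
  -- symmetrically for `k` and `e`.
  have hNj : ∀ u, G.Adj j u → u = i ∨ u = k := fun u hu =>
    hef.dominated.eq_or_eq ((ofAdj_moved_iff hij j).2 (Or.inr rfl)) hij.ne' hjk hu
  have hNk : ∀ u, G.Adj k u → u = i ∨ u = j := fun u hu =>
    hef.symm.dominated.eq_or_eq ((ofAdj_moved_iff hik k).2 (Or.inr rfl)) hik.ne' hjk.symm hu
  -- Otherwise `j` is a leaf and `e` would be minimal.
  have hadj : G.Adj j k := by
    by_contra h
    refine hmin (isMinimal_ofAdj_of_leaf hij fun u hu => (hNj u hu).resolve_right ?_)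
    rintro rfl
    exact h hu
  -- If the third side were a twin too, `i` would have no neighbours besides `j` and `k`, and the
  -- whole graph would be the triangle.
  have hx : ¬ (ofAdj hij).Twin (ofAdj hadj) := by
    intro h
    refine hG' ⟨i, j, k, hij, hadj, hik, mem_of_adj_closed hG {x | x = i ∨ x = j ∨ x = k}
      (Or.inl rfl) ?_⟩
    rintro x (rfl | rfl | rfl) y hy
    · exact Or.inr (h.dominated.eq_or_eq ((ofAdj_moved_iff hij x).2 (Or.inl rfl)) hij.ne hik.ne hy)
    · rcases hNj y hy with h | h
      · exact Or.inl h
      · exact Or.inr (Or.inr h)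
    · rcases hNk y hy with h | h
      · exact Or.inl h
      · exact Or.inr (Or.inl h)
  -- an edge at `j` or `k` is a side of the triangle
  have hedge : ∀ ρ : SimpleCycle G, ρ.IsEdge → (ofAdj hadj).Meets ρ →
      ρ = ofAdj hadj ∨ ρ = ofAdj hij ∨ ρ = ofAdj hik := by
    intro ρ hρ hm
    have hext : ∀ (τ : SimpleCycle G) (v : V), τ.IsEdge → ρ.1 v ≠ v → τ.1 v ≠ v →
        ρ.1 v = τ.1 v → ρ = τ := by
      intro τ v hτ h1 h2 h3
      have h4 := hρ.eq_ofAdj h1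
      have h5 := hτ.eq_ofAdj h2
      rw [h4, h5]
      congr 1
    rcases (ofAdj_meets_iff hadj ρ).1 hm with h | h
    · rcases hNj _ (ρ.2.2 j h) with h1 | h1
      · refine Or.inr (Or.inl (hext _ j (isEdge_ofAdj hij) h ?_ ?_))
        · exact (ofAdj_moved_iff hij j).2 (Or.inr rfl)
        · rw [h1, ofAdj_right]
      · refine Or.inl (hext _ j (isEdge_ofAdj hadj) h ?_ ?_)
        · exact (ofAdj_moved_iff hadj j).2 (Or.inl rfl)
        · rw [h1, ofAdj_left]
    · rcases hNk _ (ρ.2.2 k h) with h1 | h1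
      · refine Or.inr (Or.inr (hext _ k (isEdge_ofAdj hik) h ?_ ?_))
        · exact (ofAdj_moved_iff hik k).2 (Or.inr rfl)
        · rw [h1, ofAdj_right]
      · refine Or.inl (hext _ k (isEdge_ofAdj hadj) h ?_ ?_)
        · exact (ofAdj_moved_iff hadj k).2 (Or.inr rfl)
        · rw [h1, ofAdj_right]
  refine ⟨⟨ofAdj hadj, hx, fun ρ => ⟨fun hm => ?_, ?_⟩⟩, fun ρ => ⟨fun h => ?_, ?_⟩⟩
  · by_cases hρ : ρ.IsEdge
    · rcases hedge ρ hρ hm with h | rfl | rfl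
      · exact Or.inl h
      · exact Or.inr (twin_refl _)
      · exact Or.inr hef
    · -- a long cycle through `j` or `k` runs around the triangle
      right
      have hall : ρ.1 i ≠ i ∧ ρ.1 j ≠ j ∧ ρ.1 k ≠ k ∧ ∀ x ∈ ({i, j, k} : Set V),
          ρ.1 x ∈ ({i, j, k} : Set V) := by
        have hjk_mem : ρ.1 j ≠ j ∧ ρ.1 k ≠ k := by
          rcases (ofAdj_meets_iff hadj ρ).1 hm with h | h
          · refine ⟨h, ?_⟩
            rcases hNj _ (ρ.2.2 j h) with h1 | h1
            · rcases hNj _ (adj_symm_apply h) with h2 | h2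
              · exact absurd (h2.trans h1.symm) (symm_apply_ne_apply hρ h)
              · rw [← h2]; exact symm_apply_moved h
            · rw [← h1]; exact apply_moved h
          · refine ⟨?_, h⟩
            rcases hNk _ (ρ.2.2 k h) with h1 | h1
            · rcases hNk _ (adj_symm_apply h) with h2 | h2
              · exact absurd (h2.trans h1.symm) (symm_apply_ne_apply hρ h)
              · rw [← h2]; exact symm_apply_moved h
            · rw [← h1]; exact apply_moved h
        obtain ⟨h1, h2⟩ := hjk_mem
        have e1 := hNj _ (ρ.2.2 j h1)
        have e2 := hNj _ (adj_symm_apply h1)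
        have e3 := hNk _ (ρ.2.2 k h2)
        have e4 := hNk _ (adj_symm_apply h2)
        have n1 := symm_apply_ne_apply hρ h1
        have n2 := symm_apply_ne_apply hρ h2
        have n3 := apply_apply_ne hρ h1
        have n4 := apply_apply_ne hρ h2
        simp only [Equiv.symm_apply_eq] at e2 e4
        -- The two cases are the two directions around the triangle.
        rcases e1 with e1 | e1
        · have e4' : k = ρ.1 i := by
            rcases e4 with e4 | e4
            · exact e4
            · exact absurd (e4.trans e1) hik.ne'
          have e3' : ρ.1 k = j := by
            rcases e3 with e3 | e3
            · exact absurd (ρ.1.injective (e1.trans e3.symm)) hjk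
            · exact e3
          refine ⟨e4' ▸ hik.ne', h1, h2, ?_⟩
          rintro x (rfl | rfl | rfl)
          · rw [← e4']; simp
          · rw [e1]; simp
          · rw [e3']; simp
        · have e3' : ρ.1 k = i := by
            rcases e3 with e3 | e3
            · exact e3
            · exact absurd (by rw [e1, e3]) n3
          have e2' : j = ρ.1 i := by
            rcases e2 with e2 | e2
            · exact e2
            · exact absurd (e2.trans e3') hij.ne'
          refine ⟨e2' ▸ hij.ne', h1, h2, ?_⟩
          rintro x (rfl | rfl | rfl)
          · rw [← e2']; simp
          · rw [e1]; simp
          · rw [e3']; simp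
      obtain ⟨h1, h2, h3, h4⟩ := hall
      refine fun π => ⟨fun h => ofAdj_dominated hij h1 h2 π h, ?_⟩
      rintro ⟨v, hv, hv'⟩
      rcases ρ.mem_of_closed _ h1 (by simp) h4 hv with rfl | rfl | rfl
      · exact (ofAdj_meets_iff hij π).2 (Or.inl hv')
      · exact (ofAdj_meets_iff hij π).2 (Or.inr hv')
      · exact (hef π).2 ((ofAdj_meets_iff hik π).2 (Or.inr hv'))
  · rintro (rfl | h)
    · exact meets_self _
    · exact ((h _).1 ((ofAdj_meets_iff hij _).2
        (Or.inr ((ofAdj_moved_iff hadj j).2 (Or.inl rfl))))).symm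
  · rcases hedge ρ h.2 ((h.1 _).1 ((ofAdj_meets_iff hij _).2
      (Or.inr ((ofAdj_moved_iff hadj j).2 (Or.inl rfl))))).symm with rfl | h1
    · exact absurd h.1 hx
    · exact h1
  · rintro (rfl | rfl)
    · exact ⟨twin_refl _, he⟩
    · exact ⟨hef, hf⟩

/-- Take two consecutive edges of `σ`, the first starting at a vertex shared with `x`. If the first
is not `x` it is a twin of `σ`; if it is `x`, the second meets `x` and differs from it because `σ`
is long. -/
theorem exists_edge_of_isolating [Finite V] {σ x : SimpleCycle G}
    (h : ∀ ρ, x.Meets ρ ↔ ρ = x ∨ σ.Twin ρ) : ∃ e, σ.Twin e ∧ e.IsEdge := by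
  classical
  by_cases hσ : σ.IsEdge
  · exact ⟨σ, σ.twin_refl, hσ⟩
  obtain ⟨v, hv, hv'⟩ := (h σ).2 (Or.inr σ.twin_refl)
  have hm : ∀ {i j : V} (hij : G.Adj i j), x.1 i ≠ i → ofAdj hij ≠ x → σ.Twin (ofAdj hij) :=
    fun hij hi hne => ((h _).1 ((ofAdj_meets_iff hij x).2 (Or.inl hi)).symm).resolve_left hne
  by_cases h1 : ofAdj (σ.2.2 v hv') = x
  · have hu := apply_moved hv'
    refine ⟨ofAdj (σ.2.2 _ hu), hm _ ?_ ?_, isEdge_ofAdj _⟩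
    · rw [← h1]
      exact (ofAdj_moved_iff _ _).2 (Or.inr rfl)
    · intro h2
      have h3 := ofAdj_left (σ.2.2 _ hu)
      rw [h2, ← h1, ofAdj_right] at h3
      exact apply_apply_ne hσ hv' h3.symm
  · exact ⟨_, hm _ hv h1, isEdge_ofAdj _⟩

open Classical in
/-- The number of edges in a class of twins depends only on the relation of meeting. -/
theorem card_twin_edges [Finite V] (hG : G.Connected) (hG' : ¬ IsTriangle G) (σ : SimpleCycle G) :
    Nat.card {τ // σ.Twin τ ∧ τ.IsEdge} =
      if σ.IsMinimal then Nat.card {τ // σ.Twin τ}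
      else if σ.IsCap then 2 else Nat.card {τ // σ.Twin τ} % 2 := by
  have hpar := σ.card_twin_modEq
  by_cases hmin : σ.IsMinimal
  · rw [if_pos hmin]
    exact Nat.card_congr (Equiv.subtypeEquivRight fun τ =>
      and_iff_left_of_imp fun h => (hmin.of_twin h).isEdge hG hG')
  rw [if_neg hmin]
  -- Two edges in a class that is not minimal form the attached triangle of `exists_of_twin_edges`.
  have htwo : 1 < Nat.card {τ // σ.Twin τ ∧ τ.IsEdge} →
      Nat.card {τ // σ.Twin τ ∧ τ.IsEdge} = 2 ∧
        ∃ x : SimpleCycle G, ¬ σ.Twin x ∧ ∀ ρ, x.Meets ρ ↔ ρ = x ∨ σ.Twin ρ := by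
    intro h
    obtain ⟨⟨e, he1, he2⟩, ⟨f, hf1, hf2⟩, hne⟩ := Finite.one_lt_card_iff_nontrivial.1 h
    have htw : ∀ ρ, σ.Twin ρ ↔ e.Twin ρ := fun ρ => ⟨he1.symm.trans, he1.trans⟩
    obtain ⟨h1, h2⟩ := exists_of_twin_edges hG hG' he2 hf2 (he1.symm.trans hf1)
      (fun h => hne (Subtype.ext h)) fun h => hmin (h.of_twin he1.symm)
    simp only [htw]
    refine ⟨?_, h1⟩
    have h3 : {τ | e.Twin τ ∧ τ.IsEdge} = {e, f} := Set.ext h2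
    have h4 := Set.ncard_pair (fun h => hne (Subtype.ext h) : e ≠ f)
    rw [← h3] at h4
    exact h4
  by_cases hcap : σ.IsCap
  · rw [if_pos hcap]
    obtain ⟨h1, x, -, h2⟩ := hcap
    obtain ⟨e, he⟩ := exists_edge_of_isolating h2
    have hpos : 0 < Nat.card {τ // σ.Twin τ ∧ τ.IsEdge} := Nat.card_pos_iff.2 ⟨⟨⟨e, he⟩⟩, inferInstance⟩
    -- The number of edges is even and positive, hence at least 2.
    refine (htwo ?_).1
    rw [Nat.even_iff] at h1
    unfold Nat.ModEq at hpar
    omega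
  · rw [if_neg hcap]
    -- Two edges would make the class a cap, so there is at most one, and parity decides.
    have hle : ¬ 1 < Nat.card {τ // σ.Twin τ ∧ τ.IsEdge} := fun h => by
      obtain ⟨h1, h2⟩ := htwo h
      refine hcap ⟨?_, h2⟩
      rw [Nat.even_iff, hpar, h1]
    rw [hpar]
    omega

end SimpleCycle

/-! ### From a correspondence of cycles to a correspondence of edges -/

open SimpleCycle in
/-- A correspondence of cycles can be changed on classes of twins so as to preserve edges. -/
theorem CyclesIso.exists_edge_equiv {W : Type*} [Finite V] [Finite W] {G : SimpleGraph V}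
    {H : SimpleGraph W} (hG : G.Connected) (hG' : ¬ IsTriangle G) (hH : H.Connected)
    (hH' : ¬ IsTriangle H) (h : CyclesIso G H) :
    ∃ ψ : {σ : SimpleCycle G // σ.IsEdge} ≃ {σ : SimpleCycle H // σ.IsEdge},
      ∀ e f, (ψ e).1.Meets (ψ f).1 ↔ e.1.Meets f.1 := by
  classical
  obtain ⟨φ, hφ⟩ := h
  have hφ' : ∀ σ τ, (φ σ).Meets τ ↔ σ.Meets (φ.symm τ) := fun σ τ => by
    rw [← hφ, φ.apply_symm_apply]
  have htwin : ∀ σ τ, (φ σ).Twin (φ τ) ↔ σ.Twin τ := fun σ τ =>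
    φ.symm.forall_congr fun {ρ} => by rw [hφ', hφ']
  have hdom : ∀ σ τ, (φ σ).Dominated (φ τ) ↔ σ.Dominated τ := fun σ τ =>
    φ.symm.forall_congr fun {ρ} => by rw [hφ', hφ']
  have hmin : ∀ σ, (φ σ).IsMinimal ↔ σ.IsMinimal := fun σ =>
    (φ.forall_congr fun {τ} => by rw [hdom, hdom]).symm
  have hcard : ∀ σ, Nat.card {τ // (φ σ).Twin τ} = Nat.card {τ // σ.Twin τ} := fun σ =>
    (Nat.card_congr (φ.subtypeEquiv fun τ => (htwin σ τ).symm)).symm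
  have hcap : ∀ σ, (φ σ).IsCap ↔ σ.IsCap := fun σ => by
    unfold IsCap
    rw [hcard]
    refine and_congr Iff.rfl (φ.exists_congr fun {x} => ?_).symm
    rw [htwin]
    refine and_congr Iff.rfl (φ.forall_congr fun {ρ} => ?_)
    rw [htwin, hφ, φ.apply_eq_iff_eq]
  have hedges : ∀ σ, Nat.card {τ // σ.Twin τ ∧ τ.IsEdge} =
      Nat.card {τ // (φ σ).Twin τ ∧ τ.IsEdge} := fun σ => by
    rw [card_twin_edges hG hG', card_twin_edges hH hH', hcard]
    simp only [hmin, hcap]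
  -- The fibres of `nb` are the classes of twins. Corresponding classes contain equally many edges,
  -- so bijections chosen fibre by fibre glue to `ψ`, where `ψ e` is a twin of `φ e`; replacing
  -- cycles by twins does not affect meeting.
  let nb : SimpleCycle H → Set (SimpleCycle H) := fun σ => {τ | σ.Meets τ}
  have hnb : ∀ σ τ, nb σ = nb τ ↔ σ.Twin τ := fun σ τ => Set.ext_iff
  have hfib : ∀ S, Nonempty ({e : {σ : SimpleCycle G // σ.IsEdge} // nb (φ e.1) = S} ≃
      {e : {σ : SimpleCycle H // σ.IsEdge} // nb e.1 = S}) := by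
    intro S
    refine Finite.card_eq.1 ?_
    by_cases hS : ∃ σ, nb (φ σ) = S
    · obtain ⟨σ, rfl⟩ := hS
      refine Eq.trans ?_ ((hedges σ).trans ?_)
      · refine Nat.card_congr ((Equiv.subtypeSubtypeEquivSubtypeInter
          (fun τ : SimpleCycle G => τ.IsEdge) (fun τ => nb (φ τ) = nb (φ σ))).trans
          (Equiv.subtypeEquivRight fun τ => ?_))
        rw [hnb, htwin, and_comm]
        exact and_congr ⟨Twin.symm, Twin.symm⟩ Iff.rfl
      · refine Nat.card_congr ((Equiv.subtypeSubtypeEquivSubtypeInter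
          (fun τ : SimpleCycle H => τ.IsEdge) (fun τ => nb τ = nb (φ σ))).trans
          (Equiv.subtypeEquivRight fun τ => ?_)).symm
        rw [hnb, and_comm]
        exact and_congr ⟨Twin.symm, Twin.symm⟩ Iff.rfl
    · have h1 : IsEmpty {e : {σ : SimpleCycle G // σ.IsEdge} // nb (φ e.1) = S} :=
        ⟨fun e => hS ⟨_, e.2⟩⟩
      have h2 : IsEmpty {e : {σ : SimpleCycle H // σ.IsEdge} // nb e.1 = S} :=
        ⟨fun e => hS ⟨φ.symm e.1.1, by rw [φ.apply_symm_apply]; exact e.2⟩⟩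
      simp
  let ψ := Equiv.ofFiberEquiv fun S => (hfib S).some
  have hψ : ∀ e, (φ e.1).Twin (ψ e).1 := fun e =>
    (hnb _ _).1 (Equiv.ofFiberEquiv_map (fun S => (hfib S).some) e).symm
  refine ⟨ψ, fun e f => ?_⟩
  rw [← hψ e, ← hφ]
  exact ⟨fun h => (((hψ f) _).2 h.symm).symm, fun h => (((hψ f) _).1 h.symm).symm⟩

/-! ### Whitney's theorem on line graphs -/

section LineGraph

variable {V W E F : Type*}

/-- The type `E` with the incidence relation `inc` represents the edges of `G`. -/
structure IsEdgeModel (G : SimpleGraph V) (inc : E → V → Prop) : Prop where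
  exists_ends : ∀ e, ∃ u v, G.Adj u v ∧ ∀ w, inc e w ↔ w = u ∨ w = v
  exists_edge : ∀ u v, G.Adj u v → ∃ e, inc e u ∧ inc e v
  eq_of_inc : ∀ {e f u v}, u ≠ v → inc e u → inc e v → inc f u → inc f v → e = f

/-- Two edges have a common end point. -/
def Touch (inc : E → V → Prop) (e f : E) : Prop := ∃ v, inc e v ∧ inc f v

/-- Every further edge touches none or exactly two of the three given edges. -/
def EvenTriple (inc : E → V → Prop) (e₁ e₂ e₃ : E) : Prop :=
  ∀ f, f ≠ e₁ → f ≠ e₂ → f ≠ e₃ →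
    (Touch inc f e₁ ∧ Touch inc f e₂ ∧ ¬ Touch inc f e₃) ∨
    (Touch inc f e₁ ∧ ¬ Touch inc f e₂ ∧ Touch inc f e₃) ∨
    (¬ Touch inc f e₁ ∧ Touch inc f e₂ ∧ Touch inc f e₃) ∨
    (¬ Touch inc f e₁ ∧ ¬ Touch inc f e₂ ∧ ¬ Touch inc f e₃)

/-- Three distinct edges with a common end point that form an even triple. -/
def HasEvenStar (inc : E → V → Prop) : Prop :=
  ∃ e₁ e₂ e₃ x, e₁ ≠ e₂ ∧ e₁ ≠ e₃ ∧ e₂ ≠ e₃ ∧ inc e₁ x ∧ inc e₂ x ∧ inc e₃ x ∧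
    EvenTriple inc e₁ e₂ e₃

namespace IsEdgeModel

variable {G : SimpleGraph V} {H : SimpleGraph W} {inc : E → V → Prop} {inc' : F → W → Prop}

theorem adj_iff (hE : IsEdgeModel G inc) {u v : V} :
    G.Adj u v ↔ u ≠ v ∧ ∃ e, inc e u ∧ inc e v := by
  refine ⟨fun h => ⟨h.ne, hE.exists_edge u v h⟩, ?_⟩
  rintro ⟨hne, e, hu, hv⟩
  obtain ⟨a, b, hab, h⟩ := hE.exists_ends e
  rcases (h u).1 hu with rfl | rfl <;> rcases (h v).1 hv with rfl | rfl
  · exact absurd rfl hne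
  · exact hab
  · exact hab.symm
  · exact absurd rfl hne

theorem exists_other (hE : IsEdgeModel G inc) {e : E} {u : V} (hu : inc e u) :
    ∃ v, u ≠ v ∧ ∀ w, inc e w ↔ w = u ∨ w = v := by
  obtain ⟨a, b, hab, h⟩ := hE.exists_ends e
  rcases (h u).1 hu with rfl | rfl
  · exact ⟨b, hab.ne, h⟩
  · exact ⟨a, hab.ne', fun w => (h w).trans or_comm⟩

theorem inc_iff (hE : IsEdgeModel G inc) {e : E} {u v : V} (hne : u ≠ v) (hu : inc e u)
    (hv : inc e v) (w : V) : inc e w ↔ w = u ∨ w = v := by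
  obtain ⟨v', -, h⟩ := hE.exists_other hu
  rcases (h v).1 hv with rfl | rfl
  · exact absurd rfl hne
  · exact h w

/-- Three edges that touch each other without a common end point are the sides of a triangle. -/
theorem exists_triangle (hE : IsEdgeModel G inc) {e₁ e₂ e₃ : E} (h12 : Touch inc e₁ e₂)
    (h13 : Touch inc e₁ e₃) (h23 : Touch inc e₂ e₃)
    (h : ¬ ∃ x, inc e₁ x ∧ inc e₂ x ∧ inc e₃ x) :
    ∃ p q r, p ≠ q ∧ p ≠ r ∧ q ≠ r ∧ (∀ w, inc e₁ w ↔ w = q ∨ w = r) ∧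
      (∀ w, inc e₂ w ↔ w = p ∨ w = r) ∧ (∀ w, inc e₃ w ↔ w = p ∨ w = q) := by
  obtain ⟨r, hr1, hr2⟩ := h12
  obtain ⟨q, hq1, hq3⟩ := h13
  obtain ⟨p, hp2, hp3⟩ := h23
  have hpq : p ≠ q := by rintro rfl; exact h ⟨_, hq1, hp2, hp3⟩
  have hpr : p ≠ r := by rintro rfl; exact h ⟨_, hr1, hp2, hp3⟩
  have hqr : q ≠ r := by rintro rfl; exact h ⟨_, hq1, hr2, hq3⟩
  exact ⟨p, q, r, hpq, hpr, hqr, hE.inc_iff hqr hq1 hr1, hE.inc_iff hpr hp2 hr2,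
    hE.inc_iff hpq hp3 hq3⟩

/-- A further edge contains at most one corner of the triangle, and each corner lies on exactly two
sides. -/
theorem evenTriple_of_triangle (hE : IsEdgeModel G inc) {e₁ e₂ e₃ : E} (h12 : Touch inc e₁ e₂)
    (h13 : Touch inc e₁ e₃) (h23 : Touch inc e₂ e₃)
    (h : ¬ ∃ x, inc e₁ x ∧ inc e₂ x ∧ inc e₃ x) : EvenTriple inc e₁ e₂ e₃ := by
  obtain ⟨p, q, r, hpq, hpr, hqr, h1, h2, h3⟩ := hE.exists_triangle h12 h13 h23 h
  intro f hf1 hf2 hf3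
  have n1 : ¬ (inc f q ∧ inc f r) := fun h => hf1 (hE.eq_of_inc hqr h.1 h.2 ((h1 q).2 (Or.inl rfl))
    ((h1 r).2 (Or.inr rfl)))
  have n2 : ¬ (inc f p ∧ inc f r) := fun h => hf2 (hE.eq_of_inc hpr h.1 h.2 ((h2 p).2 (Or.inl rfl))
    ((h2 r).2 (Or.inr rfl)))
  have n3 : ¬ (inc f p ∧ inc f q) := fun h => hf3 (hE.eq_of_inc hpq h.1 h.2 ((h3 p).2 (Or.inl rfl))
    ((h3 q).2 (Or.inr rfl)))
  have t1 : Touch inc f e₁ ↔ inc f q ∨ inc f r := by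
    simp only [Touch, h1, and_or_left, exists_or, exists_eq_right]
  have t2 : Touch inc f e₂ ↔ inc f p ∨ inc f r := by
    simp only [Touch, h2, and_or_left, exists_or, exists_eq_right]
  have t3 : Touch inc f e₃ ↔ inc f p ∨ inc f q := by
    simp only [Touch, h3, and_or_left, exists_or, exists_eq_right]
  rw [t1, t2, t3]
  by_cases hp : inc f p
  · have hr : ¬ inc f r := fun h => n2 ⟨hp, h⟩
    have hq : ¬ inc f q := fun h => n3 ⟨hp, h⟩
    simp [hp, hq, hr]
  · by_cases hq : inc f q
    · have hr : ¬ inc f r := fun h => n1 ⟨hq, h⟩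
      simp [hp, hq, hr]
    · by_cases hr : inc f r <;> simp [hp, hq, hr]

theorem exists_inc (hE : IsEdgeModel G inc) (hG : G.Connected) [Nonempty E] (v : V) :
    ∃ e, inc e v := by
  by_contra h
  obtain ⟨e⟩ := ‹Nonempty E›
  obtain ⟨a, b, -, h'⟩ := hE.exists_ends e
  have : a ∈ ({v} : Set V) := mem_of_adj_closed hG {v} rfl (by
    rintro x rfl y hy
    obtain ⟨f, hf, -⟩ := hE.exists_edge x y hy
    exact absurd ⟨f, hf⟩ h) a
  exact h ⟨e, (h' v).2 (Or.inl this.symm)⟩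

/-- If the edges at `u` and the edges at `v` are just `e = uv`, then `e` is the only edge. -/
theorem subsingleton_of_isolated (hE : IsEdgeModel G inc) (hG : G.Connected) {e : E} {u v : V}
    (he : ∀ w, inc e w ↔ w = u ∨ w = v) (hu : ∀ f, inc f u → f = e) (hv : ∀ f, inc f v → f = e)
    (f : E) : f = e := by
  have hall : ∀ w, w ∈ ({u, v} : Set V) := mem_of_adj_closed hG _ (Or.inl rfl) (by
    rintro x (rfl | rfl) y hy
    · obtain ⟨f, h1, h2⟩ := hE.exists_edge x y hy
      rw [hu f h1] at h2
      exact (he y).1 h2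
    · obtain ⟨f, h1, h2⟩ := hE.exists_edge x y hy
      rw [hv f h1] at h2
      exact (he y).1 h2)
  obtain ⟨a, b, -, h⟩ := hE.exists_ends f
  have ha : inc f a := (h a).2 (Or.inl rfl)
  rcases hall a with rfl | rfl
  · exact hu f ha
  · exact hv f ha

/-- If `ψ` and its inverse map edges with a common end point to such edges, then the edges at each
vertex are mapped to the edges at some vertex. -/
theorem exists_vertex (hE : IsEdgeModel G inc) (hF : IsEdgeModel H inc') (hG : G.Connected)
    [Nontrivial E] (ψ : E ≃ F) (hψ : ∀ e f, Touch inc' (ψ e) (ψ f) ↔ Touch inc e f)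
    (hs : ∀ e₁ e₂ e₃, e₁ ≠ e₂ → e₁ ≠ e₃ → e₂ ≠ e₃ → ((∃ x, inc e₁ x ∧ inc e₂ x ∧ inc e₃ x) ↔
      ∃ y, inc' (ψ e₁) y ∧ inc' (ψ e₂) y ∧ inc' (ψ e₃) y)) (v : V) :
    ∃ w, ∀ e, inc e v ↔ inc' (ψ e) w := by
  -- Two edges at `v` determine `w` as the common end of their images; a third edge is handled by
  -- the hypothesis on stars.
  have htwo : ∀ (v : V) (e₁ e₂ : E), e₁ ≠ e₂ → inc e₁ v → inc e₂ v →
      ∃ w, ∀ e, inc e v ↔ inc' (ψ e) w := by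
    intro v e₁ e₂ hne h1 h2
    obtain ⟨w, hw1, hw2⟩ := (hψ e₁ e₂).2 ⟨v, h1, h2⟩
    refine ⟨w, fun e => ?_⟩
    by_cases he1 : e₁ = e
    · subst he1; exact iff_of_true h1 hw1
    by_cases he2 : e₂ = e
    · subst he2; exact iff_of_true h2 hw2
    constructor
    · intro he
      obtain ⟨y, hy1, hy2, hy⟩ := (hs e₁ e₂ e hne he1 he2).1 ⟨v, h1, h2, he⟩
      by_cases hyw : y = w
      · exact hyw ▸ hy
      · exact absurd (ψ.injective (hF.eq_of_inc hyw hy1 hw1 hy2 hw2)) hne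
    · intro he
      obtain ⟨y, hy1, hy2, hy⟩ := (hs e₁ e₂ e hne he1 he2).2 ⟨w, hw1, hw2, he⟩
      by_cases hyv : y = v
      · exact hyv ▸ hy
      · exact absurd (hE.eq_of_inc hyv hy1 h1 hy2 h2) hne
  obtain ⟨e, he⟩ := hE.exists_inc hG v
  by_cases hv : ∀ f, inc f v → f = e
  · obtain ⟨u, huv, hends⟩ := hE.exists_other he
    have hu : ∃ f, inc f u ∧ f ≠ e := by
      by_contra! h
      obtain ⟨f, hf⟩ := exists_ne e
      exact hf (hE.subsingleton_of_isolated hG hends hv h f)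
    obtain ⟨f, hfu, hfe⟩ := hu
    have heu := (hends u).2 (Or.inr rfl)
    obtain ⟨u', hu'⟩ := htwo u e f hfe.symm heu hfu
    obtain ⟨w, huw, hw⟩ := hF.exists_other ((hu' e).1 heu)
    have hew : inc' (ψ e) w := (hw w).2 (Or.inr rfl)
    refine ⟨w, fun g => ⟨fun hg => ?_, fun hg => ?_⟩⟩
    · rwa [hv g hg]
    · by_cases hge : g = e
      · rwa [hge]
      · obtain ⟨z, hz, hze⟩ := (hψ g e).1 ⟨w, hg, hew⟩
        rcases (hends z).1 hze with rfl | rfl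
        · exact hz
        · exact absurd (ψ.injective
            (hF.eq_of_inc huw ((hu' g).1 hz) hg ((hu' e).1 heu) hew)) hge
  · push Not at hv
    obtain ⟨f, hf, hfe⟩ := hv
    exact htwo v f e hfe hf he

/-- Distinct vertices with the same edges would be joined by an edge that is a whole component,
contrary to there being two edges. -/
theorem eq_of_same_edges (hE : IsEdgeModel G inc) (hG : G.Connected) [Nontrivial E] {u v : V}
    (h : ∀ e, inc e u ↔ inc e v) : u = v := by
  by_contra hne
  obtain ⟨e, he⟩ := hE.exists_inc hG u
  obtain ⟨f, hf⟩ := exists_ne e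
  have hends := hE.inc_iff hne he ((h e).1 he)
  exact hf (hE.subsingleton_of_isolated hG hends
    (fun g hg => hE.eq_of_inc hne hg ((h g).1 hg) he ((h e).1 he))
    (fun g hg => hE.eq_of_inc hne ((h g).2 hg) hg he ((h e).1 he)) f)

theorem nonempty_iso_of_star_iff (hE : IsEdgeModel G inc) (hF : IsEdgeModel H inc')
    (hG : G.Connected) (hH : H.Connected)
    [Nontrivial E] (ψ : E ≃ F) (hψ : ∀ e f, Touch inc' (ψ e) (ψ f) ↔ Touch inc e f)
    (hs : ∀ e₁ e₂ e₃, e₁ ≠ e₂ → e₁ ≠ e₃ → e₂ ≠ e₃ → ((∃ x, inc e₁ x ∧ inc e₂ x ∧ inc e₃ x) ↔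
      ∃ y, inc' (ψ e₁) y ∧ inc' (ψ e₂) y ∧ inc' (ψ e₃) y)) : Nonempty (G ≃g H) := by
  have : Nontrivial F := ψ.symm.nontrivial
  choose f hf using hE.exists_vertex hF hG ψ hψ hs
  have hinv := hF.exists_vertex hE hH ψ.symm
    (fun e f => by rw [← hψ, ψ.apply_symm_apply, ψ.apply_symm_apply])
    (fun e₁ e₂ e₃ h1 h2 h3 => by
      have := hs _ _ _ (ψ.symm.injective.ne h1) (ψ.symm.injective.ne h2) (ψ.symm.injective.ne h3)
      simpa using this.symm)
  have hbij : Function.Bijective f := by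
    constructor
    · intro u v huv
      exact hE.eq_of_same_edges hG fun e => by rw [hf, hf, huv]
    · intro w
      obtain ⟨v, hv⟩ := hinv w
      refine ⟨v, hF.eq_of_same_edges hH fun e => ?_⟩
      rw [hv, hf, ψ.apply_symm_apply]
  refine ⟨⟨Equiv.ofBijective f hbij, fun {u v} => ?_⟩⟩
  rw [hE.adj_iff, hF.adj_iff, Equiv.ofBijective_apply, Equiv.ofBijective_apply, hbij.1.ne_iff]
  refine and_congr Iff.rfl ((ψ.exists_congr fun {e} => ?_).symm)
  rw [hf, hf]

end IsEdgeModel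

/-- The adjacency matrix of a graph on four vertices. -/
def adjFour (a b c d e f : Bool) : Fin 4 → Fin 4 → Bool :=
  ![![false, a, b, c], ![a, false, d, e], ![b, d, false, f], ![c, e, f, false]]

theorem exists_equiv_adjFour {G : SimpleGraph V} {x y z t : V} (hxy : x ≠ y) (hxz : x ≠ z)
    (hxt : x ≠ t) (hyz : y ≠ z) (hyt : y ≠ t) (hzt : z ≠ t)
    (hall : ∀ v, v = x ∨ v = y ∨ v = z ∨ v = t) {a b c d e f : Bool}
    (ha : G.Adj x y ↔ a = true) (hb : G.Adj x z ↔ b = true) (hc : G.Adj x t ↔ c = true)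
    (hd : G.Adj y z ↔ d = true) (he : G.Adj y t ↔ e = true) (hf : G.Adj z t ↔ f = true) :
    ∃ l : Fin 4 ≃ V, ∀ i j, G.Adj (l i) (l j) ↔ adjFour a b c d e f i j = true := by
  have hbij : Function.Bijective ![x, y, z, t] := by
    constructor
    · intro i j
      fin_cases i <;> fin_cases j <;>
        simp [hxy, hxz, hxt, hyz, hyt, hzt, hxy.symm, hxz.symm, hxt.symm, hyz.symm, hyt.symm,
          hzt.symm]
    · intro v
      rcases hall v with rfl | rfl | rfl | rfl
      · exact ⟨0, rfl⟩
      · exact ⟨1, rfl⟩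
      · exact ⟨2, rfl⟩
      · exact ⟨3, rfl⟩
  refine ⟨Equiv.ofBijective _ hbij, fun i j => ?_⟩
  rw [Equiv.ofBijective_apply, Equiv.ofBijective_apply]
  fin_cases i <;> fin_cases j <;>
    simp [adjFour, ha, hb, hc, hd, he, hf, G.adj_comm y x, G.adj_comm z x, G.adj_comm t x,
      G.adj_comm z y, G.adj_comm t y, G.adj_comm t z]

/-- A vertex joined to three others, with a nonempty set of edges among these, gives the same graph
as a triangle, with as many edges from a fourth vertex to it. -/
theorem exists_perm_adjFour : ∀ a b c : Bool, (a || b || c) = true →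
    ∃ π : Equiv.Perm (Fin 4), ∀ i j,
      adjFour true true b true c a (π i) (π j) = adjFour true true true a c b i j := by
  decide

namespace IsEdgeModel

variable {G : SimpleGraph V} {H : SimpleGraph W} {inc : E → V → Prop} {inc' : F → W → Prop}

/-- A connected graph with an even star consists of four vertices. -/
theorem exists_of_evenStar (hE : IsEdgeModel G inc) (hG : G.Connected) {e₁ e₂ e₃ : E} {x : V}
    (h12 : e₁ ≠ e₂) (h13 : e₁ ≠ e₃) (h23 : e₂ ≠ e₃) (h1 : inc e₁ x) (h2 : inc e₂ x)
    (h3 : inc e₃ x) (h : EvenTriple inc e₁ e₂ e₃) :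
    ∃ a b c, x ≠ a ∧ x ≠ b ∧ x ≠ c ∧ a ≠ b ∧ a ≠ c ∧ b ≠ c ∧
      (∀ w, inc e₁ w ↔ w = x ∨ w = a) ∧ (∀ w, inc e₂ w ↔ w = x ∨ w = b) ∧
      (∀ w, inc e₃ w ↔ w = x ∨ w = c) ∧ ∀ v, v = x ∨ v = a ∨ v = b ∨ v = c := by
  obtain ⟨a, hxa, ha⟩ := hE.exists_other h1
  obtain ⟨b, hxb, hb⟩ := hE.exists_other h2
  obtain ⟨c, hxc, hc⟩ := hE.exists_other h3
  have hab : a ≠ b := by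
    rintro rfl
    exact h12 (hE.eq_of_inc hxa h1 ((ha a).2 (Or.inr rfl)) h2 ((hb a).2 (Or.inr rfl)))
  have hac : a ≠ c := by
    rintro rfl
    exact h13 (hE.eq_of_inc hxa h1 ((ha a).2 (Or.inr rfl)) h3 ((hc a).2 (Or.inr rfl)))
  have hbc : b ≠ c := by
    rintro rfl
    exact h23 (hE.eq_of_inc hxb h2 ((hb b).2 (Or.inr rfl)) h3 ((hc b).2 (Or.inr rfl)))
  refine ⟨a, b, c, hxa, hxb, hxc, hab, hac, hbc, ha, hb, hc,
    mem_of_adj_closed hG {v | v = x ∨ v = a ∨ v = b ∨ v = c} (Or.inl rfl) ?_⟩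
  intro y hy z hyz
  obtain ⟨f, hfy, hfz⟩ := hE.exists_edge y z hyz
  have hf := hE.inc_iff hyz.ne hfy hfz
  have t1 : Touch inc f e₁ ↔ inc f x ∨ inc f a := by
    simp only [Touch, ha, and_or_left, exists_or, exists_eq_right]
  have t2 : Touch inc f e₂ ↔ inc f x ∨ inc f b := by
    simp only [Touch, hb, and_or_left, exists_or, exists_eq_right]
  have t3 : Touch inc f e₃ ↔ inc f x ∨ inc f c := by
    simp only [Touch, hc, and_or_left, exists_or, exists_eq_right]
  by_cases hf1 : f = e₁
  · subst hf1
    rcases (ha z).1 hfz with h | h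
    · exact Or.inl h
    · exact Or.inr (Or.inl h)
  by_cases hf2 : f = e₂
  · subst hf2
    rcases (hb z).1 hfz with h | h
    · exact Or.inl h
    · exact Or.inr (Or.inr (Or.inl h))
  by_cases hf3 : f = e₃
  · subst hf3
    rcases (hc z).1 hfz with h | h
    · exact Or.inl h
    · exact Or.inr (Or.inr (Or.inr h))
  have h4 := h f hf1 hf2 hf3
  rw [t1, t2, t3] at h4
  -- An edge from the star to a new vertex would touch all three of its edges (from the centre) or
  -- exactly one (from a leaf), never zero or two.
  by_contra hz
  change ¬ (z = x ∨ z = a ∨ z = b ∨ z = c) at hz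
  simp only [not_or] at hz
  have m : ∀ w, w ≠ z → (inc f w ↔ w = y) := fun w hw => by
    rw [hf]
    exact or_iff_left hw
  rw [m x (Ne.symm hz.1), m a (Ne.symm hz.2.1), m b (Ne.symm hz.2.2.1),
    m c (Ne.symm hz.2.2.2)] at h4
  rcases hy with rfl | rfl | rfl | rfl
  · simp at h4
  · simp [hxa, hab.symm, hac.symm] at h4
  · simp [hxb, hab, hbc.symm] at h4
  · simp [hxc, hac, hbc] at h4

/-- An edge that avoids `e₃` misses the centre, so touching `e₁` and `e₂` forces it to join `a` and
`b`. The criterion uses only `Touch` and so is carried over by a line graph isomorphism. -/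
theorem star_adj_iff (hE : IsEdgeModel G inc) {e₁ e₂ e₃ : E} {x a b c : V}
    (hxa : x ≠ a) (hxb : x ≠ b) (hab : a ≠ b) (hac : a ≠ c) (hbc : b ≠ c)
    (h1 : ∀ w, inc e₁ w ↔ w = x ∨ w = a) (h2 : ∀ w, inc e₂ w ↔ w = x ∨ w = b)
    (h3 : ∀ w, inc e₃ w ↔ w = x ∨ w = c) :
    G.Adj a b ↔ ∃ f, Touch inc f e₁ ∧ Touch inc f e₂ ∧ ¬ Touch inc f e₃ := by
  rw [hE.adj_iff, and_iff_right hab]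
  refine exists_congr fun f => ?_
  simp only [Touch, h1, h2, h3, and_or_left, exists_or, exists_eq_right]
  constructor
  · rintro ⟨ha, hb⟩
    have := hE.inc_iff hab ha hb
    simp [this, hxa, hxb, hac.symm, hbc.symm]
  · tauto

/-- The criterion of `star_adj_iff` is read in a triangle with a fourth vertex: an edge off `pq`
that touches both other sides leaves from `r`, and only `s` is left as its other end. -/
theorem triangle_adj_iff (hE : IsEdgeModel G inc) {e₁ e₂ e₃ : E} {p q r s : V}
    (hpr : p ≠ r) (hqr : q ≠ r) (hps : p ≠ s) (hqs : q ≠ s) (hrs : r ≠ s)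
    (h1 : ∀ w, inc e₁ w ↔ w = q ∨ w = r) (h2 : ∀ w, inc e₂ w ↔ w = p ∨ w = r)
    (h3 : ∀ w, inc e₃ w ↔ w = p ∨ w = q) (hall : ∀ v, v = p ∨ v = q ∨ v = r ∨ v = s) :
    G.Adj r s ↔ ∃ f, Touch inc f e₁ ∧ Touch inc f e₂ ∧ ¬ Touch inc f e₃ := by
  rw [hE.adj_iff, and_iff_right hrs]
  refine exists_congr fun f => ?_
  simp only [Touch, h1, h2, h3, and_or_left, exists_or, exists_eq_right]
  constructor
  · rintro ⟨hr, hs⟩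
    have := hE.inc_iff hrs hr hs
    simp [this, hpr, hqr, hps, hqs]
  · intro h
    have hr : inc f r := by tauto
    obtain ⟨t, hrt, ht⟩ := hE.exists_other hr
    have h5 : inc f t := (ht t).2 (Or.inr rfl)
    rcases hall t with rfl | rfl | rfl | rfl
    · tauto
    · tauto
    · exact absurd rfl hrt
    · exact ⟨hr, h5⟩

theorem star_other (hE : IsEdgeModel G inc) {e₁ e₂ e₃ : E} {x a b c : V}
    (hxa : x ≠ a) (hxb : x ≠ b) (hxc : x ≠ c)
    (h1 : ∀ w, inc e₁ w ↔ w = x ∨ w = a) (h2 : ∀ w, inc e₂ w ↔ w = x ∨ w = b)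
    (h3 : ∀ w, inc e₃ w ↔ w = x ∨ w = c) (hall : ∀ v, v = x ∨ v = a ∨ v = b ∨ v = c)
    {f : E} (f1 : f ≠ e₁) (f2 : f ≠ e₂) (f3 : f ≠ e₃) :
    (inc f a ∧ inc f b) ∨ (inc f a ∧ inc f c) ∨ (inc f b ∧ inc f c) := by
  obtain ⟨u, v, huv, hf⟩ := hE.exists_ends f
  have hu := (hf u).2 (Or.inl rfl)
  have hv := (hf v).2 (Or.inr rfl)
  have n1 : ¬ (inc f x ∧ inc f a) := fun h =>
    f1 (hE.eq_of_inc hxa h.1 h.2 ((h1 x).2 (Or.inl rfl)) ((h1 a).2 (Or.inr rfl)))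
  have n2 : ¬ (inc f x ∧ inc f b) := fun h =>
    f2 (hE.eq_of_inc hxb h.1 h.2 ((h2 x).2 (Or.inl rfl)) ((h2 b).2 (Or.inr rfl)))
  have n3 : ¬ (inc f x ∧ inc f c) := fun h =>
    f3 (hE.eq_of_inc hxc h.1 h.2 ((h3 x).2 (Or.inl rfl)) ((h3 c).2 (Or.inr rfl)))
  have huv' := huv.ne
  clear huv hf h1 h2 h3 f1 f2 f3
  rcases hall u with rfl | rfl | rfl | rfl <;> rcases hall v with rfl | rfl | rfl | rfl <;>
    first
      | exact absurd rfl huv'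
      | exact (n1 ⟨hu, hv⟩).elim
      | exact (n1 ⟨hv, hu⟩).elim
      | exact (n2 ⟨hu, hv⟩).elim
      | exact (n2 ⟨hv, hu⟩).elim
      | exact (n3 ⟨hu, hv⟩).elim
      | exact (n3 ⟨hv, hu⟩).elim
      | exact Or.inl ⟨hu, hv⟩
      | exact Or.inl ⟨hv, hu⟩
      | exact Or.inr (Or.inl ⟨hu, hv⟩)
      | exact Or.inr (Or.inl ⟨hv, hu⟩)
      | exact Or.inr (Or.inr ⟨hu, hv⟩)
      | exact Or.inr (Or.inr ⟨hv, hu⟩)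

/-- A further edge joins two leaves, and these are revealed by which two edges of the star it
touches. -/
theorem eq_of_touch_iff (hE : IsEdgeModel G inc) {e₁ e₂ e₃ : E} {x a b c : V}
    (hab : a ≠ b) (hac : a ≠ c) (hbc : b ≠ c)
    (t1 : ∀ f, Touch inc f e₁ ↔ inc f x ∨ inc f a) (t2 : ∀ f, Touch inc f e₂ ↔ inc f x ∨ inc f b)
    (t3 : ∀ f, Touch inc f e₃ ↔ inc f x ∨ inc f c)
    (hother : ∀ f, f ≠ e₁ → f ≠ e₂ → f ≠ e₃ →
      (inc f a ∧ inc f b) ∨ (inc f a ∧ inc f c) ∨ (inc f b ∧ inc f c))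
    {f g : E} (f1 : f ≠ e₁) (f2 : f ≠ e₂) (f3 : f ≠ e₃) (g1 : g ≠ e₁) (g2 : g ≠ e₂) (g3 : g ≠ e₃)
    (heven : EvenTriple inc e₁ e₂ e₃) (k1 : Touch inc f e₁ ↔ Touch inc g e₁)
    (k2 : Touch inc f e₂ ↔ Touch inc g e₂) (k3 : Touch inc f e₃ ↔ Touch inc g e₃) : f = g := by
  have m1 := hother f f1 f2 f3
  have m2 := hother g g1 g2 g3
  have m3 := heven f f1 f2 f3
  have key : (inc f a ∧ inc g a ∧ inc f b ∧ inc g b) ∨ (inc f a ∧ inc g a ∧ inc f c ∧ inc g c) ∨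
      (inc f b ∧ inc g b ∧ inc f c ∧ inc g c) := by
    rw [t1, t2, t3] at m3
    rw [t1, t1] at k1
    rw [t2, t2] at k2
    rw [t3, t3] at k3
    clear t1 t2 t3 hother heven hab hac hbc f1 f2 f3 g1 g2 g3 hE
    grind
  rcases key with ⟨h1, h2, h3, h4⟩ | ⟨h1, h2, h3, h4⟩ | ⟨h1, h2, h3, h4⟩
  · exact hE.eq_of_inc hab h1 h3 h2 h4
  · exact hE.eq_of_inc hac h1 h3 h2 h4
  · exact hE.eq_of_inc hbc h1 h3 h2 h4

/-- A further edge at a triangle has exactly one end in it. -/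
theorem exists_base (hE : IsEdgeModel G inc) {e₁ e₂ e₃ : E} {p q r : V}
    (hpq : p ≠ q) (hpr : p ≠ r) (hqr : q ≠ r)
    (h1 : ∀ w, inc e₁ w ↔ w = q ∨ w = r) (h2 : ∀ w, inc e₂ w ↔ w = p ∨ w = r)
    (h3 : ∀ w, inc e₃ w ↔ w = p ∨ w = q) {f : E} (f1 : f ≠ e₁) (f2 : f ≠ e₂) (f3 : f ≠ e₃)
    (h : Touch inc f e₁ ∨ Touch inc f e₂) :
    ∃ u s, (u = p ∨ u = q ∨ u = r) ∧ s ≠ p ∧ s ≠ q ∧ s ≠ r ∧ ∀ w, inc f w ↔ w = u ∨ w = s := by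
  have n1 : ¬ (inc f q ∧ inc f r) := fun h => f1 (hE.eq_of_inc hqr h.1 h.2
    ((h1 q).2 (Or.inl rfl)) ((h1 r).2 (Or.inr rfl)))
  have n2 : ¬ (inc f p ∧ inc f r) := fun h => f2 (hE.eq_of_inc hpr h.1 h.2
    ((h2 p).2 (Or.inl rfl)) ((h2 r).2 (Or.inr rfl)))
  have n3 : ¬ (inc f p ∧ inc f q) := fun h => f3 (hE.eq_of_inc hpq h.1 h.2
    ((h3 p).2 (Or.inl rfl)) ((h3 q).2 (Or.inr rfl)))
  have hu : ∃ u, (u = p ∨ u = q ∨ u = r) ∧ inc f u := by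
    rcases h with ⟨u, h, h'⟩ | ⟨u, h, h'⟩
    · exact ⟨u, Or.inr ((h1 u).1 h'), h⟩
    · exact ⟨u, ((h2 u).1 h').imp_right Or.inr, h⟩
  obtain ⟨u, hu, hfu⟩ := hu
  obtain ⟨s, hus, hs⟩ := hE.exists_other hfu
  have hfs := (hs s).2 (Or.inr rfl)
  have key : s ≠ p ∧ s ≠ q ∧ s ≠ r := by
    clear hs h h1 h2 h3
    refine ⟨fun h => ?_, fun h => ?_, fun h => ?_⟩ <;> rw [h] at hfs hus <;>
      rcases hu with h' | h' | h' <;> rw [h'] at hfu hus <;>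
      first
        | exact hus rfl
        | exact n1 ⟨hfs, hfu⟩
        | exact n1 ⟨hfu, hfs⟩
        | exact n2 ⟨hfs, hfu⟩
        | exact n2 ⟨hfu, hfs⟩
        | exact n3 ⟨hfs, hfu⟩
        | exact n3 ⟨hfu, hfs⟩
  exact ⟨u, s, hu, key.1, key.2.1, key.2.2, hs⟩

/-- The graph `G` has four vertices and is determined by the adjacencies among the three leaves. If
the image of the star is a star, the same holds for `H`. If it is a triangle, `H` consists of it and
one more vertex `s`, and adjacency of two leaves becomes adjacency of a corner to `s`. The two
descriptions give isomorphic graphs by a finite check, as long as some further edge exists. -/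
theorem nonempty_iso_of_evenStar (hE : IsEdgeModel G inc) (hF : IsEdgeModel H inc')
    (hG : G.Connected) (hH : H.Connected) (hH' : ¬ IsTriangle H)
    (ψ : E ≃ F) (hψ : ∀ e f, Touch inc' (ψ e) (ψ f) ↔ Touch inc e f)
    (h : HasEvenStar inc) : Nonempty (G ≃g H) := by
  classical
  obtain ⟨e₁, e₂, e₃, x, h12, h13, h23, h1, h2, h3, heven⟩ := h
  have heven' : EvenTriple inc' (ψ e₁) (ψ e₂) (ψ e₃) := by
    intro f hf1 hf2 hf3
    obtain ⟨f, rfl⟩ := ψ.surjective f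
    simp only [hψ]
    exact heven f (fun h => hf1 (h ▸ rfl)) (fun h => hf2 (h ▸ rfl)) (fun h => hf3 (h ▸ rfl))
  obtain ⟨a, b, c, hxa, hxb, hxc, hab, hac, hbc, i1, i2, i3, hall⟩ :=
    hE.exists_of_evenStar hG h12 h13 h23 h1 h2 h3 heven
  have axa : G.Adj x a := hE.adj_iff.2 ⟨hxa, e₁, h1, (i1 a).2 (Or.inr rfl)⟩
  have axb : G.Adj x b := hE.adj_iff.2 ⟨hxb, e₂, h2, (i2 b).2 (Or.inr rfl)⟩
  have axc : G.Adj x c := hE.adj_iff.2 ⟨hxc, e₃, h3, (i3 c).2 (Or.inr rfl)⟩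
  have gab := hE.star_adj_iff hxa hxb hab hac hbc i1 i2 i3
  have gbc := hE.star_adj_iff hxb hxc hbc hab.symm hac.symm i2 i3 i1
  have gac := hE.star_adj_iff hxa hxc hac hab hbc.symm i1 i3 i2
  obtain ⟨l, hl⟩ := exists_equiv_adjFour (G := G) (a := true) (b := true) (c := true)
    (d := decide (G.Adj a b)) (e := decide (G.Adj a c)) (f := decide (G.Adj b c))
    hxa hxb hxc hab hac hbc hall (by simpa using axa) (by simpa using axb) (by simpa using axc)
    (by simp) (by simp) (by simp)
  have htr : ∀ e f g, (∃ k, Touch inc k e ∧ Touch inc k f ∧ ¬ Touch inc k g) ↔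
      ∃ k, Touch inc' k (ψ e) ∧ Touch inc' k (ψ f) ∧ ¬ Touch inc' k (ψ g) := fun e f g =>
    ψ.exists_congr fun {k} => by rw [hψ, hψ, hψ]
  rw [htr] at gab gbc gac
  by_cases hstar : ∃ y, inc' (ψ e₁) y ∧ inc' (ψ e₂) y ∧ inc' (ψ e₃) y
  · obtain ⟨y, y1, y2, y3⟩ := hstar
    obtain ⟨a', b', c', hxa', hxb', hxc', hab', hac', hbc', j1, j2, j3, hall'⟩ :=
      hF.exists_of_evenStar hH (ψ.injective.ne h12) (ψ.injective.ne h13) (ψ.injective.ne h23)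
        y1 y2 y3 heven'
    have axa' : H.Adj y a' := hF.adj_iff.2 ⟨hxa', _, y1, (j1 a').2 (Or.inr rfl)⟩
    have axb' : H.Adj y b' := hF.adj_iff.2 ⟨hxb', _, y2, (j2 b').2 (Or.inr rfl)⟩
    have axc' : H.Adj y c' := hF.adj_iff.2 ⟨hxc', _, y3, (j3 c').2 (Or.inr rfl)⟩
    rw [← hF.star_adj_iff hxa' hxb' hab' hac' hbc' j1 j2 j3] at gab
    rw [← hF.star_adj_iff hxb' hxc' hbc' hab'.symm hac'.symm j2 j3 j1] at gbc
    rw [← hF.star_adj_iff hxa' hxc' hac' hab' hbc'.symm j1 j3 j2] at gac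
    obtain ⟨l', hl'⟩ := exists_equiv_adjFour (G := H) (a := true) (b := true) (c := true)
      (d := decide (G.Adj a b)) (e := decide (G.Adj a c)) (f := decide (G.Adj b c))
      hxa' hxb' hxc' hab' hac' hbc' hall' (by simpa using axa') (by simpa using axb')
      (by simpa using axc') (by simp [gab]) (by simp [gac]) (by simp [gbc])
    refine ⟨⟨l.symm.trans l', fun {u v} => ?_⟩⟩
    obtain ⟨i, rfl⟩ := l.surjective u
    obtain ⟨j, rfl⟩ := l.surjective v
    simp only [Equiv.trans_apply, Equiv.symm_apply_apply]
    rw [hl, hl']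
  · have htouch : ∀ {e f}, inc e x → inc f x → Touch inc' (ψ e) (ψ f) := fun he hf =>
      (hψ _ _).2 ⟨x, he, hf⟩
    obtain ⟨p, q, r, hpq, hpr, hqr, j1, j2, j3⟩ :=
      hF.exists_triangle (htouch h1 h2) (htouch h1 h3) (htouch h2 h3) hstar
    have apq : H.Adj p q := hF.adj_iff.2 ⟨hpq, _, (j3 p).2 (Or.inl rfl), (j3 q).2 (Or.inr rfl)⟩
    have apr : H.Adj p r := hF.adj_iff.2 ⟨hpr, _, (j2 p).2 (Or.inl rfl), (j2 r).2 (Or.inr rfl)⟩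
    have aqr : H.Adj q r := hF.adj_iff.2 ⟨hqr, _, (j1 q).2 (Or.inl rfl), (j1 r).2 (Or.inr rfl)⟩
    have hother := fun f => hE.star_other hxa hxb hxc i1 i2 i3 hall (f := f)
    -- Two pairs chosen from three leaves always intersect.
    have hmeet : ∀ f g, f ≠ e₁ → f ≠ e₂ → f ≠ e₃ → g ≠ e₁ → g ≠ e₂ → g ≠ e₃ → Touch inc f g := by
      intro f g f1 f2 f3 g1 g2 g3
      rcases hother f f1 f2 f3 with ⟨h, h'⟩ | ⟨h, h'⟩ | ⟨h, h'⟩ <;>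
        rcases hother g g1 g2 g3 with ⟨k, k'⟩ | ⟨k, k'⟩ | ⟨k, k'⟩ <;>
        first
          | exact ⟨_, h, k⟩
          | exact ⟨_, h, k'⟩
          | exact ⟨_, h', k⟩
          | exact ⟨_, h', k'⟩
    have t1 : ∀ f, Touch inc f e₁ ↔ inc f x ∨ inc f a := fun f => by
      simp only [Touch, i1, and_or_left, exists_or, exists_eq_right]
    have t2 : ∀ f, Touch inc f e₂ ↔ inc f x ∨ inc f b := fun f => by
      simp only [Touch, i2, and_or_left, exists_or, exists_eq_right]
    have t3 : ∀ f, Touch inc f e₃ ↔ inc f x ∨ inc f c := fun f => by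
      simp only [Touch, i3, and_or_left, exists_or, exists_eq_right]
    have t1' : ∀ f, Touch inc' f (ψ e₁) ↔ inc' f q ∨ inc' f r := fun f => by
      simp only [Touch, j1, and_or_left, exists_or, exists_eq_right]
    have t2' : ∀ f, Touch inc' f (ψ e₂) ↔ inc' f p ∨ inc' f r := fun f => by
      simp only [Touch, j2, and_or_left, exists_or, exists_eq_right]
    have t3' : ∀ f, Touch inc' f (ψ e₃) ↔ inc' f p ∨ inc' f q := fun f => by
      simp only [Touch, j3, and_or_left, exists_or, exists_eq_right]
    have hbase : ∀ f, ψ f ≠ ψ e₁ → ψ f ≠ ψ e₂ → ψ f ≠ ψ e₃ → ∃ u s, (u = p ∨ u = q ∨ u = r) ∧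
        s ≠ p ∧ s ≠ q ∧ s ≠ r ∧ ∀ w, inc' (ψ f) w ↔ w = u ∨ w = s := by
      intro f f1 f2 f3
      refine hF.exists_base hpq hpr hqr j1 j2 j3 f1 f2 f3 ?_
      rw [hψ, hψ, t1, t2]
      rcases hother f (fun h => f1 (h ▸ rfl)) (fun h => f2 (h ▸ rfl)) (fun h => f3 (h ▸ rfl)) with
        h | h | h
      · exact Or.inl (Or.inr h.1)
      · exact Or.inl (Or.inr h.1)
      · exact Or.inr (Or.inr h.1)
    -- Without a further edge `H` would be a triangle.
    have hex : ∃ f, ψ f ≠ ψ e₁ ∧ ψ f ≠ ψ e₂ ∧ ψ f ≠ ψ e₃ := by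
      by_contra! hno
      refine hH' ⟨p, q, r, apq, aqr, apr, mem_of_adj_closed hH {v | v = p ∨ v = q ∨ v = r}
        (Or.inl rfl) ?_⟩
      intro y _ z hyz
      obtain ⟨f, -, hfz⟩ := hF.exists_edge y z hyz
      obtain ⟨f, rfl⟩ := ψ.surjective f
      change z = p ∨ z = q ∨ z = r
      by_cases f1 : ψ f = ψ e₁
      · rw [f1, j1] at hfz
        exact Or.inr hfz
      by_cases f2 : ψ f = ψ e₂
      · rw [f2, j2] at hfz
        exact hfz.imp_right Or.inr
      rw [hno f f1 f2, j3] at hfz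
      exact hfz.imp_right Or.inl
    obtain ⟨g, g1, g2, g3⟩ := hex
    obtain ⟨u, s, hu, hsp, hsq, hsr, hg⟩ := hbase g g1 g2 g3
    have hall' : ∀ v, v = p ∨ v = q ∨ v = r ∨ v = s := by
      refine mem_of_adj_closed hH {v | v = p ∨ v = q ∨ v = r ∨ v = s} (Or.inl rfl) ?_
      intro y _ z hyz
      obtain ⟨f, -, hfz⟩ := hF.exists_edge y z hyz
      obtain ⟨f, rfl⟩ := ψ.surjective f
      change z = p ∨ z = q ∨ z = r ∨ z = s
      by_cases f1 : ψ f = ψ e₁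
      · rw [f1, j1] at hfz
        exact Or.inr (hfz.imp_right Or.inl)
      by_cases f2 : ψ f = ψ e₂
      · rw [f2, j2] at hfz
        exact hfz.imp_right fun h => Or.inr (Or.inl h)
      by_cases f3 : ψ f = ψ e₃
      · rw [f3, j3] at hfz
        exact hfz.imp_right Or.inl
      obtain ⟨u', s', hu', hsp', hsq', hsr', hf⟩ := hbase f f1 f2 f3
      suffices hss : s' = s by
        rcases (hf z).1 hfz with h | h
        · rw [h]
          exact hu'.imp_right (Or.imp_right Or.inl)
        · rw [h, hss]
          exact Or.inr (Or.inr (Or.inr rfl))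
      -- Further edges with different outer ends must touch at a corner. They then touch the same
      -- sides, so their preimages touch the same edges of the star and coincide.
      by_contra hss
      have hu_eq : u' = u := by
        obtain ⟨w, hw, hw'⟩ := (hψ f g).2 (hmeet f g (fun h => f1 (h ▸ rfl))
          (fun h => f2 (h ▸ rfl)) (fun h => f3 (h ▸ rfl)) (fun h => g1 (h ▸ rfl))
          (fun h => g2 (h ▸ rfl)) (fun h => g3 (h ▸ rfl)))
        rcases (hf w).1 hw with h | h <;> rcases (hg w).1 hw' with h' | h'
        · rw [← h, h']
        · rw [← h, h'] at hu'
          exact (hu'.elim hsp (Or.rec hsq hsr)).elim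
        · rw [← h', h] at hu
          exact (hu.elim hsp' (Or.rec hsq' hsr')).elim
        · exact absurd (h.symm.trans h') hss
      have hsame : ∀ w, w ≠ s → w ≠ s' → (inc' (ψ f) w ↔ inc' (ψ g) w) := fun w k k' => by
        rw [hf, hg, or_iff_left k, or_iff_left k', hu_eq]
      have hfg : f = g := by
        refine hE.eq_of_touch_iff hab hac hbc t1 t2 t3 hother (fun h => f1 (h ▸ rfl))
          (fun h => f2 (h ▸ rfl)) (fun h => f3 (h ▸ rfl)) (fun h => g1 (h ▸ rfl))
          (fun h => g2 (h ▸ rfl)) (fun h => g3 (h ▸ rfl)) heven ?_ ?_ ?_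
        · rw [← hψ, ← hψ, t1', t1', hsame q hsq.symm hsq'.symm, hsame r hsr.symm hsr'.symm]
        · rw [← hψ, ← hψ, t2', t2', hsame p hsp.symm hsp'.symm, hsame r hsr.symm hsr'.symm]
        · rw [← hψ, ← hψ, t3', t3', hsame p hsp.symm hsp'.symm, hsame q hsq.symm hsq'.symm]
      have h' := (hf s').2 (Or.inr rfl)
      rw [hfg, hg] at h'
      refine h'.elim (fun h => ?_) hss
      rw [h] at hsp' hsq' hsr'
      exact hu.elim hsp' (Or.rec hsq' hsr')
    -- The leaf pairs `ab`, `bc`, `ac` correspond to the corners `r`, `p`, `q`, the common ends of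
    -- the respective image edges.
    rw [← hF.triangle_adj_iff hpr hqr hsp.symm hsq.symm hsr.symm j1 j2 j3 hall'] at gab
    rw [← hF.triangle_adj_iff (p := q) (q := r) (r := p) hpq.symm hpr.symm hsq.symm hsr.symm
      hsp.symm (fun w => (j2 w).trans or_comm) (fun w => (j3 w).trans or_comm) j1
      (fun v => (hall' v).elim (fun h => Or.inr (Or.inr (Or.inl h)))
        (Or.imp_right (Or.imp_right Or.inr)))] at gbc
    rw [← hF.triangle_adj_iff (p := p) (q := r) (r := q) hpq hqr.symm hsp.symm hsr.symm
      hsq.symm (fun w => (j1 w).trans or_comm) j3 j2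
      (fun v => (hall' v).imp_right or_left_comm.1)] at gac
    obtain ⟨l', hl'⟩ := exists_equiv_adjFour (G := H) (a := true) (b := true)
      (c := decide (G.Adj b c)) (d := true) (e := decide (G.Adj a c)) (f := decide (G.Adj a b))
      hpq hpr hsp.symm hqr hsq.symm hsr.symm hall' (by simpa using apq) (by simpa using apr)
      (by simp [gbc]) (by simpa using aqr) (by simp [gac]) (by simp [gab])
    obtain ⟨π, hπ⟩ := exists_perm_adjFour (decide (G.Adj a b)) (decide (G.Adj b c))
      (decide (G.Adj a c)) (by
        simp only [Bool.or_eq_true, decide_eq_true_eq]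
        rcases hother g (fun h => g1 (h ▸ rfl)) (fun h => g2 (h ▸ rfl)) (fun h => g3 (h ▸ rfl)) with
          ⟨h, h'⟩ | ⟨h, h'⟩ | ⟨h, h'⟩
        · exact Or.inl (Or.inl (hE.adj_iff.2 ⟨hab, g, h, h'⟩))
        · exact Or.inr (hE.adj_iff.2 ⟨hac, g, h, h'⟩)
        · exact Or.inl (Or.inr (hE.adj_iff.2 ⟨hbc, g, h, h'⟩)))
    refine ⟨⟨l.symm.trans (π.trans l'), fun {u v} => ?_⟩⟩
    obtain ⟨i, rfl⟩ := l.surjective u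
    obtain ⟨j, rfl⟩ := l.surjective v
    simp only [Equiv.trans_apply, Equiv.symm_apply_apply]
    rw [hl, hl', hπ]

/-- Whitney's theorem: connected graphs other than the triangle with isomorphic line graphs are
isomorphic. -/
theorem nonempty_iso (hE : IsEdgeModel G inc) (hF : IsEdgeModel H inc')
    (hG : G.Connected) (hH : H.Connected) (hG' : ¬ IsTriangle G) (hH' : ¬ IsTriangle H)
    (ψ : E ≃ F) (hψ : ∀ e f, Touch inc' (ψ e) (ψ f) ↔ Touch inc e f) : Nonempty (G ≃g H) := by
  have hψ' : ∀ e f, Touch inc (ψ.symm e) (ψ.symm f) ↔ Touch inc' e f := fun e f => by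
    rw [← hψ, ψ.apply_symm_apply, ψ.apply_symm_apply]
  by_cases hsE : HasEvenStar inc
  · exact hE.nonempty_iso_of_evenStar hF hG hH hH' ψ hψ hsE
  by_cases hsF : HasEvenStar inc'
  · exact (hF.nonempty_iso_of_evenStar hE hH hG hG' ψ.symm hψ' hsF).map RelIso.symm
  rcases isEmpty_or_nonempty E with hemp | ⟨⟨e⟩⟩
  · -- both graphs consist of a single vertex
    have hemp' : IsEmpty F := ψ.symm.isEmpty
    have sV : ∀ u v : V, u = v := fun u v => (mem_of_adj_closed hG {u} rfl (fun x _ y hy =>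
      isEmptyElim (hE.exists_edge x y hy).choose) v : v = u).symm
    have sW : ∀ u v : W, u = v := fun u v => (mem_of_adj_closed hH {u} rfl (fun x _ y hy =>
      isEmptyElim (hF.exists_edge x y hy).choose) v : v = u).symm
    obtain ⟨v⟩ := hG.nonempty
    obtain ⟨w⟩ := hH.nonempty
    exact ⟨⟨⟨fun _ => w, fun _ => v, fun _ => sV _ _, fun _ => sW _ _⟩, fun {a b} => by
      rw [sV a b]; simp⟩⟩
  by_cases hone : ∀ f, f = e
  · -- both graphs consist of a single edge
    have hone' : ∀ f, f = ψ e := fun f => by rw [← hone (ψ.symm f), ψ.apply_symm_apply]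
    obtain ⟨u, v, huv, he⟩ := hE.exists_ends e
    obtain ⟨u', v', huv', he'⟩ := hF.exists_ends (ψ e)
    have hV : ∀ w, w = u ∨ w = v := fun w => by
      have := (⟨e⟩ : Nonempty E)
      obtain ⟨f, hf⟩ := hE.exists_inc hG w
      rw [hone f] at hf
      exact (he w).1 hf
    have hW : ∀ w, w = u' ∨ w = v' := fun w => by
      have := (⟨ψ e⟩ : Nonempty F)
      obtain ⟨f, hf⟩ := hF.exists_inc hH w
      rw [hone' f] at hf
      exact (he' w).1 hf
    classical
    have hvu : v ≠ u := huv.ne'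
    have hvu' : v' ≠ u' := huv'.ne'
    refine ⟨⟨⟨fun w => if w = u then u' else v', fun w => if w = u' then u else v,
      fun w => ?_, fun w => ?_⟩, fun {a b} => ?_⟩⟩
    · rcases hV w with rfl | rfl
      · simp
      · simp [hvu, hvu']
    · rcases hW w with rfl | rfl
      · simp
      · simp [hvu, hvu']
    · rcases hV a with rfl | rfl <;> rcases hV b with rfl | rfl <;>
        simp [hvu, huv, huv.symm, huv', huv'.symm]
  · have : Nontrivial E := by
      push Not at hone
      obtain ⟨f, hf⟩ := hone
      exact ⟨f, e, hf⟩
    -- A star sent to a triangle, in either direction, would be an even star, since triangles are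
    -- even and evenness is preserved; these have been excluded.
    refine hE.nonempty_iso_of_star_iff hF hG hH ψ hψ fun e₁ e₂ e₃ h12 h13 h23 => ⟨?_, ?_⟩
    · rintro ⟨x, h1, h2, h3⟩
      by_contra hno
      have h4 := hF.evenTriple_of_triangle ((hψ _ _).2 ⟨x, h1, h2⟩) ((hψ _ _).2 ⟨x, h1, h3⟩)
        ((hψ _ _).2 ⟨x, h2, h3⟩) hno
      refine hsE ⟨e₁, e₂, e₃, x, h12, h13, h23, h1, h2, h3, fun f f1 f2 f3 => ?_⟩
      simpa only [hψ] using h4 (ψ f) (ψ.injective.ne f1) (ψ.injective.ne f2) (ψ.injective.ne f3)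
    · rintro ⟨x, h1, h2, h3⟩
      by_contra hno
      have h4 := hE.evenTriple_of_triangle ((hψ _ _).1 ⟨x, h1, h2⟩) ((hψ _ _).1 ⟨x, h1, h3⟩)
        ((hψ _ _).1 ⟨x, h2, h3⟩) hno
      refine hsF ⟨_, _, _, x, ψ.injective.ne h12, ψ.injective.ne h13, ψ.injective.ne h23, h1, h2,
        h3, fun f f1 f2 f3 => ?_⟩
      obtain ⟨f, rfl⟩ := ψ.surjective f
      simpa only [hψ] using h4 f (fun h => f1 (h ▸ rfl)) (fun h => f2 (h ▸ rfl))
        (fun h => f3 (h ▸ rfl))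

end IsEdgeModel

end LineGraph

/-! ### Cycles of length two as edges, and the conclusion -/

theorem SimpleCycle.isEdgeModel [Finite V] (G : SimpleGraph V) :
    IsEdgeModel G fun (e : {σ : SimpleCycle G // σ.IsEdge}) v => e.1.1 v ≠ v := by
  classical
  have hinc : ∀ (e : {σ : SimpleCycle G // σ.IsEdge}) (u v : V), u ≠ v → e.1.1 u ≠ u →
      e.1.1 v ≠ v → e.1.1 u = v := by
    intro e u v hne hu hv
    rw [e.2.eq_ofAdj hu] at hv
    rcases (ofAdj_moved_iff _ v).1 hv with h | h
    · exact absurd h.symm hne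
    · exact h.symm
  refine ⟨fun e => ?_, fun u v h => ?_, fun {e f u v} hne h1 h2 h3 h4 => ?_⟩
  · obtain ⟨v, hv⟩ := e.1.exists_moved
    refine ⟨v, e.1.1 v, e.1.2.2 v hv, fun w => ?_⟩
    have := ofAdj_moved_iff (e.1.2.2 v hv) w
    rwa [← e.2.eq_ofAdj hv] at this
  · exact ⟨⟨ofAdj h, isEdge_ofAdj h⟩, (ofAdj_moved_iff h u).2 (Or.inl rfl),
      (ofAdj_moved_iff h v).2 (Or.inr rfl)⟩
  · refine Subtype.ext ?_
    rw [e.2.eq_ofAdj h1, f.2.eq_ofAdj h3]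
    congr 1
    rw [hinc e u v hne h1 h2, hinc f u v hne h3 h4]

theorem CyclesIso.nonempty_iso {W : Type*} [Finite V] [Finite W] {G : SimpleGraph V}
    {H : SimpleGraph W} (hG : G.Connected) (hG' : ¬ IsTriangle G) (hH : H.Connected)
    (hH' : ¬ IsTriangle H) (h : CyclesIso G H) : Nonempty (G ≃g H) := by
  obtain ⟨ψ, hψ⟩ := h.exists_edge_equiv hG hG' hH hH'
  exact (SimpleCycle.isEdgeModel G).nonempty_iso (SimpleCycle.isEdgeModel H) hG hH hG' hH' ψ hψ

theorem IsTriangle.nonempty_iso {G : SimpleGraph V} (h : IsTriangle G) :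
    Nonempty (G ≃g (⊤ : SimpleGraph (Fin 3))) := by
  obtain ⟨i, j, k, hij, hjk, hik, hall⟩ := h
  have hbij : Function.Bijective ![i, j, k] := by
    constructor
    · intro a b
      fin_cases a <;> fin_cases b <;>
        simp [hij.ne, hjk.ne, hik.ne, hij.ne', hjk.ne', hik.ne']
    · intro v
      rcases hall v with rfl | rfl | rfl
      · exact ⟨0, rfl⟩
      · exact ⟨1, rfl⟩
      · exact ⟨2, rfl⟩
  refine Nonempty.map RelIso.symm ⟨⟨Equiv.ofBijective _ hbij, fun {a b} => ?_⟩⟩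
  rw [Equiv.ofBijective_apply, Equiv.ofBijective_apply]
  fin_cases a <;> fin_cases b <;> simp [hij, hjk, hik, hij.symm, hjk.symm, hik.symm]

theorem connected_star (n : ℕ) : (completeBipartiteGraph (Fin 1) (Fin n)).Connected := by
  rw [SimpleGraph.connected_iff_exists_forall_reachable]
  refine ⟨Sum.inl 0, fun v => ?_⟩
  rcases v with v | v
  · rw [Subsingleton.elim v 0]
  · exact SimpleGraph.Adj.reachable (by simp)

theorem not_isTriangle_star (n : ℕ) : ¬ IsTriangle (completeBipartiteGraph (Fin 1) (Fin n)) := by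
  rintro ⟨i, j, k, hij, hjk, hik, -⟩
  rcases i with i | i <;> rcases j with j | j <;> rcases k with k | k <;> simp_all

end HikeTheory

theorem mainTheorem1 :
    (∀ (V W : Type*) [Finite V] [Finite W] (G : SimpleGraph V) (H : SimpleGraph W),
      G.Connected → H.Connected →
      ¬ Nonempty (G ≃g (⊤ : SimpleGraph (Fin 3))) →
      ¬ Nonempty (G ≃g completeBipartiteGraph (Fin 1) (Fin 5)) →
      Nonempty (HikeTheory.HikePoset (HikeTheory.bidirected G) ≃o
        HikeTheory.HikePoset (HikeTheory.bidirected H)) →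
      Nonempty (G ≃g H)) ∧
    Nonempty (HikeTheory.HikePoset (HikeTheory.bidirected (⊤ : SimpleGraph (Fin 3))) ≃o
      HikeTheory.HikePoset
        (HikeTheory.bidirected (completeBipartiteGraph (Fin 1) (Fin 5)))) := by
  refine ⟨fun V W _ _ G H hG hH h3 h5 ⟨e⟩ => ?_,
    HikeTheory.nonempty_orderIso_completeGraph_three_star_five⟩
  have hG' : ¬ HikeTheory.IsTriangle G := fun h => h3 h.nonempty_iso
  have h := HikeTheory.cyclesIso_of_orderIso e
  -- Whitney's theorem does not apply to a triangle `H`, but K₁,₅ has the same cycles up to meeting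
  -- and may take its place; then `G` would be K₁,₅, which is excluded.
  by_cases hH' : HikeTheory.IsTriangle H
  · obtain ⟨f⟩ := hH'.nonempty_iso
    obtain ⟨g⟩ := HikeTheory.nonempty_orderIso_completeGraph_three_star_five
    have h' := (h.trans (HikeTheory.cyclesIso_of_iso f)).trans (HikeTheory.cyclesIso_of_orderIso g)
    exact absurd (h'.nonempty_iso hG hG' (HikeTheory.connected_star 5)
      (HikeTheory.not_isTriangle_star 5)) h5
  · exact h.nonempty_iso hG hG' hH hH'
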